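/- Let $G\in C^{2,\alpha}([-1,1])$ for some $\alpha\in(0,1)$, with $G\ge 0$, $G(t)=0$ only for $t=\pm1$, and $G''(\pm1)>0$, and let $f=-G'$. Let $\mathbb{R}^2_+=\{(x,y)\in\mathbb{R}^2: y>0\}$ and let $\nu=(0,-1)$ be its outward normal. By a solution we mean a function $V$ with values in $[-1,1]$, of class $C^1$ up to the boundary of $\mathbb{R}^2_+$, with $$\Delta V=0 \ \text{ in } \mathbb{R}^2_+,\qquad \frac{\partial V}{\partial \nu}=f(V)\ \text{ on } \partial\mathbb{R}^2_+=\mathbb{R}\times\{0\}.$$ A layer solution is a solution $U$ with $-1<U<1$ and $U_x>0$ in $\overline{\mathbb{R}^2_+}$ and $U(x,0)\to\pm1$ as $x\to\pm\infty$. (a) (No homoclinic solutions) If $V$ is a solution and $V(x,0)\to-1$ as $x\to+\infty$ and as $x\to-\infty$, then $V\equiv-1$. (b) If $V$ is a solution and $|V(x,0)|\to1$ as $x\to+\infty$ and as $x\to-\infty$, then either $V\equiv 1$, or $V\equiv-1$, or $V$ is a layer solution or the reflection $(x,y)\mapsto U(-x,y)$ of a layer solution. In the last case, given any layer solution $U$,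 there exists $b\in\mathbb{R}$ such that $V(x,y)=U(x-b,y)$ for all $(x,y)\in\overline{\mathbb{R}^2_+}$, or $V(x,y)=U(-(x-b),y)$ for all $(x,y)\in\overline{\mathbb{R}^2_+}$. -/

import Mathlib

open Set Filter Topology InnerProductSpace

namespace HalfPlane

/-- Double-well potentials: `G ∈ C^{2,α}([-1,1])` for some `α ∈ (0,1)`, `G ≥ 0`, `G` vanishes
exactly at `±1`, and `G''(±1) > 0`. Only the restriction of `G` to `[-1,1]` matters; derivatives
are taken within `[-1,1]`, hence one-sided at the end points. -/
structure IsDoubleWell (G : ℝ → ℝ) : Prop where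
  contDiffOn : ContDiffOn ℝ 2 G (Icc (-1) 1)
  holder : ∃ α : NNReal, 0 < α ∧ α < 1 ∧ ∃ C : NNReal,
    HolderOnWith C α (iteratedDerivWithin 2 G (Icc (-1) 1)) (Icc (-1) 1)
  nonneg : ∀ t ∈ Icc (-1 : ℝ) 1, 0 ≤ G t
  eq_zero_iff : ∀ t ∈ Icc (-1 : ℝ) 1, G t = 0 ↔ t = -1 ∨ t = 1
  second_deriv_left : 0 < iteratedDerivWithin 2 G (Icc (-1) 1) (-1)
  second_deriv_right : 0 < iteratedDerivWithin 2 G (Icc (-1) 1) 1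

/-- The nonlinearity `f = -G'` on `[-1,1]`. -/
noncomputable def reaction (G : ℝ → ℝ) (t : ℝ) : ℝ := -derivWithin G (Icc (-1) 1) t

/-- Classical solutions `V` with values in `[-1,1]` of `ΔV = 0` in the open upper half-plane,
`∂V/∂ν = f(V)` on its boundary, with `V` of class `C¹` up to the boundary. The point `(x, y)` is
the complex number `x + iy`; the outward normal is `ν = (0, -1)`, so the boundary condition says
that the one-sided derivative `∂V/∂y (x, 0)` equals `-f(V(x, 0))`. The values of `V` below the
real axis play no role. -/
structure IsSolution (f : ℝ → ℝ) (V : ℂ → ℝ) : Prop where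
  contDiffOn : ContDiffOn ℝ 1 V {z : ℂ | 0 ≤ z.im}
  harmonic : HarmonicOnNhd V {z : ℂ | 0 < z.im}
  boundary : ∀ x : ℝ,
    HasDerivWithinAt (fun y : ℝ => V ⟨x, y⟩) (-f (V ⟨x, 0⟩)) (Ici 0) 0
  mem_Icc : ∀ z : ℂ, 0 ≤ z.im → V z ∈ Icc (-1 : ℝ) 1

/-- (Increasing) layer solutions: solutions with `-1 < U < 1` and `∂U/∂x > 0` in the closed upper
half-plane, and `U(x, 0) → ±1` as `x → ±∞`. -/
structure IsLayer (f : ℝ → ℝ) (U : ℂ → ℝ) : Prop where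
  isSolution : IsSolution f U
  mem_Ioo : ∀ z : ℂ, 0 ≤ z.im → U z ∈ Ioo (-1 : ℝ) 1
  deriv_pos : ∀ x y : ℝ, 0 ≤ y → 0 < deriv (fun t : ℝ => U ⟨t, y⟩) x
  tendsto_atBot : Tendsto (fun x : ℝ => U ⟨x, 0⟩) atBot (𝓝 (-1))
  tendsto_atTop : Tendsto (fun x : ℝ => U ⟨x, 0⟩) atTop (𝓝 1)

end HalfPlane

/-! Write `f = -G'`. For (a), pass to logarithmic polar coordinates, where half-circles become
vertical segments of a strip. Let `E(s)` be the integral of the squared gradient over such a segment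
and `γ(s)` the sum of `G(V)` at the two boundary points `±e^s`. Testing the equation with `V - e`
(`energy_identity`) produces `A` with `A² ≤ 4πE`. Convexity of `G` near its zero `e` gives `A' ≥ E +
e^s γ` far out. Then `A² ≤ 4πA'`, a Riccati inequality that would blow up if `A'` stayed above a
positive constant (`exists_deriv_lt_of_sq_le`); hence `E` and `e^s γ` are simultaneously small at
arbitrarily large `s`. Cauchy's theorem for the square of the complex gradient (`pohozaev_identity`)
bounds `∫ e^s γ` by these end terms, and the contribution near the origin also vanishes. So `G(V) =
0` on the boundary, and continuity leaves only the constant `e`.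

For (b), the boundary trace has a limit `±1` at each end. Equal limits fall under (a), for either
sign; opposite limits give, after reflection, a connection from `-1` to `1`. Since `f` is strictly
decreasing near `±1`, a difference of two connections cannot have a negative boundary minimum where
both are near the same end state. Sliding one until it touches the other, and applying the Hopf
lemma at the contact point, shows that they are translates (`exists_translate`). Sliding a
connection against itself gives monotonicity.

Strict positivity of `V_x` at the boundary is delicate because `V` is only `C¹` there. At a boundary
zero, Hopf gives `V_x ≥ c y` above the point, while the trace of `V_y = -f(V)` is stationary, so
`(V_x)_y = (V_y)_x` is at most `c/2` just above it (`exists_tangential_deriv_le`), a contradiction.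
-/

namespace HalfPlane

/-! ### Harmonic functions in the plane: maximum principles -/

lemma HarmonicAt.exists_analyticAt_re {u : ℂ → ℝ} {z : ℂ} (hu : HarmonicAt u z) :
    ∃ F : ℂ → ℂ, AnalyticAt ℂ F z ∧ u =ᶠ[𝓝 z] fun w => (F w).re := by
  obtain ⟨r, hr, hball⟩ := Metric.isOpen_iff.1 (isOpen_setOfPred_harmonicAt (f := u)) z hu
  obtain ⟨F, hF, hFu⟩ := InnerProductSpace.HarmonicOnNhd.exists_analyticOnNhd_ball_re_eq
    (f := u) (z := z) (R := r) (fun y hy => hball hy)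
  exact ⟨F, hF z (Metric.mem_ball_self hr),
    Filter.eventually_of_mem (Metric.ball_mem_nhds z hr) fun y hy => (hFu hy).symm⟩

lemma HarmonicAt.comp_analyticAt {u : ℂ → ℝ} {φ : ℂ → ℂ} {z : ℂ} (hu : HarmonicAt u (φ z))
    (hφ : AnalyticAt ℂ φ z) : HarmonicAt (fun w => u (φ w)) z := by
  obtain ⟨F, hF, hFu⟩ := HarmonicAt.exists_analyticAt_re hu
  have h := (AnalyticAt.comp hF hφ).harmonicAt_re
  refine (harmonicAt_congr_nhds ?_).2 h
  exact hφ.continuousAt.eventually hFu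

/-- The reflection `x + iy ↦ -x + iy`. -/
lemma HarmonicAt.comp_reflection {u : ℂ → ℝ} {z : ℂ} (hu : HarmonicAt u ⟨-z.re, z.im⟩) :
    HarmonicAt (fun w : ℂ => u ⟨-w.re, w.im⟩) z := by
  have hu' : HarmonicAt u (-(starRingEnd ℂ z)) := by
    convert hu using 1
    apply Complex.ext <;> simp
  obtain ⟨F, hF, hFu⟩ := HarmonicAt.exists_analyticAt_re hu'
  have hF2 : AnalyticAt ℂ (fun w => F (-w)) (starRingEnd ℂ z) :=
    AnalyticAt.comp (g := F) (f := fun w => -w) hF (by fun_prop)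
  -- Conjugating before and after restores holomorphy and leaves the real part unchanged.
  have hF3 : AnalyticAt ℂ (fun w => starRingEnd ℂ (F (-(starRingEnd ℂ w)))) z := by
    have := hF2.eventually_analyticAt
    rw [Complex.analyticAt_iff_eventually_differentiableAt]
    have h4 := Complex.continuous_conj.continuousAt.eventually this
    filter_upwards [h4] with w hw
    have := hw.differentiableAt.conj_conj
    simpa [Function.comp_def] using this
  refine (harmonicAt_congr_nhds ?_).2 hF3.harmonicAt_re
  have hc : ContinuousAt (fun w : ℂ => -(starRingEnd ℂ w)) z :=
    Complex.continuous_conj.neg.continuousAt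
  filter_upwards [hc.eventually hFu] with w hw
  rw [Complex.conj_re, ← hw]
  congr 1
  apply Complex.ext <;> simp

/-- If `u = Re F`, then `|exp F| = exp u`, so the maximum modulus principle for `exp ∘ F` applies.
-/
lemma HarmonicAt.eventually_eq_of_isLocalMax {u : ℂ → ℝ} {z : ℂ} (hu : HarmonicAt u z)
    (hz : IsLocalMax u z) : ∀ᶠ w in 𝓝 z, u w = u z := by
  obtain ⟨F, hF, hFu⟩ := HarmonicAt.exists_analyticAt_re hu
  have hd : ∀ᶠ w in 𝓝 z, DifferentiableAt ℂ (fun w => Complex.exp (F w)) w := by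
    filter_upwards [hF.eventually_analyticAt] with w hw
    exact hw.differentiableAt.cexp
  have hmax : IsLocalMax (norm ∘ fun w => Complex.exp (F w)) z := by
    filter_upwards [hz, hFu] with w hw hw'
    simp only [Function.comp, Complex.norm_exp, Real.exp_le_exp]
    have h0 : u z = (F z).re := hFu.self_of_nhds
    rw [← hw', ← h0]
    exact hw
  filter_upwards [Complex.eventually_eq_of_isLocalMax_norm hd hmax, hFu] with w hw hw'
  rw [hw', hFu.self_of_nhds]
  have := congrArg norm hw
  simpa [Complex.norm_exp] using this

/-- Maximum principle on an arbitrary open set, with conditions at the frontier and at infinity. -/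
theorem le_of_frontier_of_cocompact {u : ℂ → ℝ} {U : Set ℂ} (hU : IsOpen U)
    (hu : HarmonicOnNhd u U) {M : ℝ}
    (hfr : ∀ ζ ∈ frontier U, ∀ ε > 0, ∀ᶠ z in 𝓝[U] ζ, u z ≤ M + ε)
    (hinf : ∀ ε > 0, ∀ᶠ z in cocompact ℂ, z ∈ U → u z ≤ M + ε) :
    ∀ z ∈ U, u z ≤ M := by
  intro z₀ hz₀
  by_contra! hlt
  set ε := (u z₀ - M) / 2 with hε
  have hεpos : 0 < ε := by rw [hε]; linarith
  -- Since `M + ε < u z₀`, this superlevel set stays away from the frontier and from infinity, so it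
  -- is compact.
  set K := {z ∈ U | u z₀ ≤ u z} with hK
  have hKU : K ⊆ U := fun z hz => hz.1
  have hKclosed : IsClosed K := by
    refine isClosed_of_closure_subset fun ζ hζ => ?_
    have hζU : ζ ∈ closure U := closure_mono hKU hζ
    by_cases hmem : ζ ∈ U
    · refine ⟨hmem, ?_⟩
      have hc : ContinuousAt u ζ := (hu ζ hmem).1.continuousAt
      by_contra! h
      have h2 : ∀ᶠ z in 𝓝 ζ, u z < u z₀ := hc.eventually_lt continuousAt_const h
      obtain ⟨z, hz1, hz2⟩ := (mem_closure_iff_frequently.1 hζ |>.and_eventually h2).exists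
      exact absurd hz1.2 (not_le.2 hz2)
    · have hf : ζ ∈ frontier U := by
        rw [hU.frontier_eq]; exact ⟨hζU, hmem⟩
      have h2 := eventually_nhdsWithin_iff.1 (hfr ζ hf ε hεpos)
      obtain ⟨z, hz1, hz2⟩ := (mem_closure_iff_frequently.1 hζ |>.and_eventually h2).exists
      have := hz2 hz1.1
      have := hz1.2
      linarith
  have hKcomp : IsCompact K := by
    obtain ⟨t, ht, hts⟩ := mem_cocompact.1 (hinf ε hεpos)
    refine ht.of_isClosed_subset hKclosed fun z hz => ?_
    by_contra hzt
    have := hts hzt hz.1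
    have := hz.2
    linarith
  have hcont : ContinuousOn u K := hu.continuousOn.mono hKU
  obtain ⟨z₁, hz₁K, hz₁⟩ := hKcomp.exists_isMaxOn ⟨z₀, hz₀, le_rfl⟩ hcont
  have hz₁' : ∀ z ∈ U, u z ≤ u z₁ := fun z hz => by
    by_cases h : u z₀ ≤ u z
    · exact hz₁ ⟨hz, h⟩
    · exact (not_le.1 h).le.trans hz₁K.2
  -- The set of maximum points is nonempty, compact and clopen in `ℂ`, which is connected and not
  -- compact.
  set S := K ∩ u ⁻¹' {u z₁} with hS
  have hSclosed : IsClosed S := hcont.preimage_isClosed_of_isClosed hKclosed isClosed_singleton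
  have hSopen : IsOpen S := by
    refine isOpen_iff_mem_nhds.2 fun z hz => ?_
    have hzU : z ∈ U := hz.1.1
    have hzval : u z = u z₁ := hz.2
    have hmax : IsLocalMax u z := by
      filter_upwards [hU.mem_nhds hzU] with w hw
      rw [hzval]; exact hz₁' w hw
    filter_upwards [HarmonicAt.eventually_eq_of_isLocalMax (hu z hzU) hmax, hU.mem_nhds hzU]
      with w hw hwU
    have : u w = u z₁ := hw.trans hzval
    exact ⟨⟨hwU, this ▸ hz₁K.2⟩, this⟩
  have huniv : S = univ := IsClopen.eq_univ ⟨hSclosed, hSopen⟩ ⟨z₁, hz₁K, rfl⟩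
  have : IsCompact S := hKcomp.of_isClosed_subset hSclosed inter_subset_left
  rw [huniv] at this
  exact noncompact_univ ℂ this

/-- Maximum principle on a bounded open set. -/
theorem le_of_frontier_of_isBounded {u : ℂ → ℝ} {U : Set ℂ} (hU : IsOpen U)
    (hb : Bornology.IsBounded U) (hu : HarmonicOnNhd u U) (hc : ContinuousOn u (closure U)) {M : ℝ}
    (hfr : ∀ ζ ∈ frontier U, u ζ ≤ M) : ∀ z ∈ closure U, u z ≤ M := by
  have key : ∀ z ∈ U, u z ≤ M := by
    refine le_of_frontier_of_cocompact hU hu (fun ζ hζ ε hε => ?_) (fun ε _ => ?_)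
    · have h1 : Tendsto u (𝓝[U] ζ) (𝓝 (u ζ)) :=
        (hc ζ (frontier_subset_closure hζ)).mono subset_closure
      filter_upwards [h1.eventually (eventually_lt_nhds (show u ζ < M + ε by
        have := hfr ζ hζ; linarith))] with z hz using hz.le
    · filter_upwards [hb.isCompact_closure.compl_mem_cocompact] with z hz hzU
      exact absurd (subset_closure hzU) hz
  intro z hz
  by_cases h : z ∈ U
  · exact key z h
  · exact hfr z (by rw [hU.frontier_eq]; exact ⟨hz, h⟩)

lemma isOpen_upper : IsOpen {z : ℂ | 0 < z.im} := isOpen_lt continuous_const Complex.continuous_im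

lemma isClosed_upper : IsClosed {z : ℂ | 0 ≤ z.im} := isClosed_le continuous_const Complex.continuous_im

lemma frontier_upper : frontier {z : ℂ | 0 < z.im} = {z : ℂ | z.im = 0} := Complex.frontier_setOfPred_lt_im 0

/-- Phragmén–Lindelöf principle for bounded harmonic functions in the half-plane. -/
theorem le_of_boundary_le {u : ℂ → ℝ} (hu : HarmonicOnNhd u {z : ℂ | 0 < z.im})
    (hc : ContinuousOn u {z : ℂ | 0 ≤ z.im}) {C M : ℝ} (hb : ∀ z : ℂ, 0 ≤ z.im → u z ≤ C)
    (hM : ∀ x : ℝ, u ⟨x, 0⟩ ≤ M) : ∀ z : ℂ, 0 ≤ z.im → u z ≤ M := by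
  have hlog : ∀ z : ℂ, 0 ≤ z.im → 0 ≤ Real.log ‖z + Complex.I‖ := fun z hz => by
    apply Real.log_nonneg
    have := Complex.abs_im_le_norm (z + Complex.I)
    have h2 := le_abs_self (z + Complex.I).im
    simp at h2 this
    linarith
  have hne : ∀ z : ℂ, 0 ≤ z.im → z + Complex.I ≠ 0 := fun z hz h => by
    have := congrArg Complex.im h
    simp at this; linarith
  -- The correction `δ log |z + i|` is harmonic, nonnegative on the closed half-plane and unbounded
  -- at infinity; it absorbs the bound `C`, and then `δ → 0`.
  have key : ∀ δ > 0, ∀ z ∈ {z : ℂ | 0 < z.im}, u z - δ * Real.log ‖z + Complex.I‖ ≤ M := by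
    intro δ hδ
    refine le_of_frontier_of_cocompact (u := fun z => u z - δ * Real.log ‖z + Complex.I‖)
      isOpen_upper ?_ (fun ζ hζ ε hε => ?_) (fun ε _ => ?_)
    · intro z hz
      have h1 : HarmonicAt (fun z => Real.log ‖z + Complex.I‖) z :=
        AnalyticAt.harmonicAt_log_norm (f := fun z => z + Complex.I) (by fun_prop)
          (hne z (le_of_lt hz))
      exact (hu z hz).sub (h1.const_smul (c := δ))
    · rw [frontier_upper] at hζ
      have hζ' : ζ.im = 0 := hζ
      have hζM : u ζ ≤ M := by
        have := hM ζ.re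
        rwa [show (⟨ζ.re, 0⟩ : ℂ) = ζ from Complex.ext rfl hζ'.symm] at this
      have h1 : Tendsto u (𝓝[{z : ℂ | 0 < z.im}] ζ) (𝓝 (u ζ)) :=
        (hc ζ hζ'.ge).mono fun z (hz : 0 < z.im) => hz.le
      filter_upwards [h1.eventually (eventually_lt_nhds (show u ζ < M + ε by linarith)),
        self_mem_nhdsWithin] with z hz hz'
      have := mul_nonneg hδ.le (hlog z (le_of_lt hz'))
      linarith
    · have h1 : Tendsto (fun z : ℂ => Real.log ‖z + Complex.I‖) (cocompact ℂ) atTop := by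
        refine Real.tendsto_log_atTop.comp (tendsto_norm_cocompact_atTop.comp ?_)
        exact (Homeomorph.addRight Complex.I).isClosedEmbedding.tendsto_cocompact
      filter_upwards [h1.eventually_ge_atTop ((C - M - ε) / δ)] with z hz hzU
      have h2 := hb z (le_of_lt hzU)
      rw [div_le_iff₀ hδ] at hz
      linarith
  intro z hz
  rcases hz.eq_or_lt with h0 | h0
  · have := hM z.re
    rwa [show (⟨z.re, 0⟩ : ℂ) = z from Complex.ext rfl h0] at this
  · have h1 : Tendsto (fun δ : ℝ => u z - δ * Real.log ‖z + Complex.I‖) (𝓝[>] 0) (𝓝 (u z)) := by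
      have : Tendsto (fun δ : ℝ => u z - δ * Real.log ‖z + Complex.I‖) (𝓝 0)
          (𝓝 (u z - 0 * Real.log ‖z + Complex.I‖)) := Continuous.tendsto (by fun_prop) 0
      simp only [zero_mul, sub_zero] at this
      exact this.mono_left nhdsWithin_le_nhds
    exact le_of_tendsto h1 (eventually_nhdsWithin_of_forall fun δ hδ => key δ hδ z h0)

theorem ge_of_boundary_ge {u : ℂ → ℝ} (hu : HarmonicOnNhd u {z : ℂ | 0 < z.im})
    (hc : ContinuousOn u {z : ℂ | 0 ≤ z.im}) {C M : ℝ} (hb : ∀ z : ℂ, 0 ≤ z.im → C ≤ u z)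
    (hM : ∀ x : ℝ, M ≤ u ⟨x, 0⟩) : ∀ z : ℂ, 0 ≤ z.im → M ≤ u z := fun z hz => by
  have := le_of_boundary_le (u := -u) hu.neg hc.neg (C := -C) (M := -M)
    (fun z hz => neg_le_neg (hb z hz)) (fun x => neg_le_neg (hM x)) z hz
  exact neg_le_neg_iff.1 this

/-- Strong minimum principle in the half-plane. -/
theorem eq_zero_of_nonneg {u : ℂ → ℝ} (hu : HarmonicOnNhd u {z : ℂ | 0 < z.im})
    (h0 : ∀ z : ℂ, 0 < z.im → 0 ≤ u z) {z₀ : ℂ} (hz₀ : 0 < z₀.im) (hu₀ : u z₀ = 0) :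
    ∀ z : ℂ, 0 < z.im → u z = 0 := by
  have hpre : IsPreconnected {z : ℂ | 0 < z.im} :=
    (convex_halfSpace_im_gt 0).isPreconnected
  have hopen : IsOpen {z : ℂ | 0 < z.im ∧ u z = 0} := by
    refine isOpen_iff_mem_nhds.2 fun z hz => ?_
    have hmax : IsLocalMax (-u) z := by
      filter_upwards [isOpen_upper.mem_nhds hz.1] with w hw
      simpa [hz.2] using h0 w hw
    filter_upwards [HarmonicAt.eventually_eq_of_isLocalMax (hu z hz.1).neg hmax,
      isOpen_upper.mem_nhds hz.1] with w hw hw'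
    exact ⟨hw', by simpa [hz.2] using hw⟩
  have hopen' : IsOpen {z : ℂ | 0 < z.im ∧ u z ≠ 0} := by
    refine isOpen_iff_mem_nhds.2 fun z hz => ?_
    filter_upwards [isOpen_upper.mem_nhds hz.1,
      (hu z hz.1).1.continuousAt.eventually_ne hz.2] with w hw hw' using ⟨hw, hw'⟩
  intro z hz
  by_contra hne
  obtain ⟨w, -, hw1, hw2⟩ := hpre _ _ hopen hopen' (fun w hw => by
    by_cases h : u w = 0
    · exact Or.inl ⟨hw, h⟩
    · exact Or.inr ⟨hw, h⟩) ⟨z₀, hz₀, hz₀, hu₀⟩ ⟨z, hz, hz, hne⟩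
  exact hw2.2 hw1.2

/-! ### Boundary behaviour of harmonic functions in the half-plane -/

lemma continuous_mk_right (x : ℝ) : Continuous fun y : ℝ => (⟨x, y⟩ : ℂ) := by
  have : (fun y : ℝ => (⟨x, y⟩ : ℂ)) = fun y : ℝ => (x : ℂ) + y * Complex.I := by
    funext y; apply Complex.ext <;> simp
  exact this ▸ (by fun_prop)

lemma continuous_mk_left (y : ℝ) : Continuous fun x : ℝ => (⟨x, y⟩ : ℂ) := by
  have : (fun x : ℝ => (⟨x, y⟩ : ℂ)) = fun x : ℝ => (x : ℂ) + y * Complex.I := by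
    funext x; apply Complex.ext <;> simp
  exact this ▸ (by fun_prop)

theorem le_of_rect {u : ℂ → ℝ} {a b c d M : ℝ} (hab : a < b) (hcd : c < d)
    (hu : HarmonicOnNhd u (Ioo a b ×ℂ Ioo c d)) (hc : ContinuousOn u (Icc a b ×ℂ Icc c d))
    (hM : ∀ z ∈ Icc a b ×ℂ Icc c d,
      z.re = a ∨ z.re = b ∨ z.im = c ∨ z.im = d → u z ≤ M) :
    ∀ z ∈ Icc a b ×ℂ Icc c d, u z ≤ M := by
  have hcl : closure (Ioo a b ×ℂ Ioo c d) = Icc a b ×ℂ Icc c d := by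
    rw [Complex.closure_reProdIm, closure_Ioo hab.ne, closure_Ioo hcd.ne]
  have hop : IsOpen (Ioo a b ×ℂ Ioo c d) := isOpen_Ioo.reProdIm isOpen_Ioo
  rw [← hcl] at hc
  have := le_of_frontier_of_isBounded hop
    ((Metric.isBounded_Ioo a b).reProdIm (Metric.isBounded_Ioo c d)) hu hc (M := M) ?_
  · rwa [hcl] at this
  · intro ζ hζ
    rw [hop.frontier_eq, hcl] at hζ
    refine hM ζ hζ.1 ?_
    have h1 := hζ.1
    have h2 := hζ.2
    simp only [Complex.mem_reProdIm, mem_Icc, mem_Ioo, not_and_or, not_lt] at h1 h2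
    rcases h2 with (h2 | h2) | (h2 | h2)
    · exact Or.inl (le_antisymm h2 h1.1.1)
    · exact Or.inr (Or.inl (le_antisymm h1.1.2 h2))
    · exact Or.inr (Or.inr (Or.inl (le_antisymm h2 h1.2.1)))
    · exact Or.inr (Or.inr (Or.inr (le_antisymm h1.2.2 h2)))

/-- Hopf boundary lemma in the half-plane. -/
theorem exists_linear_lower_bound {P : ℂ → ℝ} (hP : HarmonicOnNhd P {z : ℂ | 0 < z.im})
    (hc : ContinuousOn P {z : ℂ | 0 ≤ z.im}) (h0 : ∀ z : ℂ, 0 ≤ z.im → 0 ≤ P z)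
    (hpos : ∀ z : ℂ, 0 < z.im → 0 < P z) (x₀ : ℝ) :
    ∃ c > 0, ∀ y ∈ Icc (0 : ℝ) 1, c * y ≤ P ⟨x₀, y⟩ := by
  have htop : IsCompact (Icc (x₀ - 1) (x₀ + 1) ×ℂ {(1 : ℝ)}) :=
    isCompact_Icc.reProdIm isCompact_singleton
  obtain ⟨z₁, hz₁, hmin⟩ := htop.exists_isMinOn
    ⟨⟨x₀, 1⟩, by simp [Complex.mem_reProdIm]⟩ (hc.mono fun z hz => by
      have : z.im = 1 := hz.2
      simp [this])
  have him : z₁.im = 1 := hz₁.2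
  set m := P z₁ with hm
  have hmpos : 0 < m := hpos z₁ (by rw [him]; exact one_pos)
  -- With `ζ = z - x₀`, the barrier `Im (ζ - ζ³)` vanishes on the bottom of the rectangle, is
  -- nonpositive on the lateral sides, at most `2` on the top, and at least `y` on the central axis.
  set b : ℂ → ℝ := fun z => ((z - x₀) - (z - x₀) ^ 3).im with hb
  have hbval : ∀ z : ℂ, b z = z.im * (1 - 3 * (z.re - x₀) ^ 2 + z.im ^ 2) := fun z => by
    simp only [hb, Complex.sub_im, Complex.ofReal_im, sub_zero, pow_succ, pow_zero, one_mul,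
      Complex.mul_im, Complex.mul_re, Complex.sub_re, Complex.ofReal_re]
    ring
  have key : ∀ z ∈ Icc (x₀ - 1) (x₀ + 1) ×ℂ Icc (0 : ℝ) 1, (m / 2) * b z - P z ≤ 0 := by
    refine le_of_rect (u := fun z => (m / 2) * b z - P z) (by linarith) one_pos ?_ ?_ ?_
    · intro z hz
      have h1 : HarmonicAt b z :=
        AnalyticAt.harmonicAt_im (f := fun z : ℂ => (z - x₀) - (z - x₀) ^ 3) (by fun_prop)
      exact (h1.const_smul (c := m / 2)).sub (hP z hz.2.1)
    · refine ContinuousOn.sub (Continuous.continuousOn ?_) (hc.mono fun z hz => hz.2.1)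
      simp only [hb]
      fun_prop
    · intro z hz hbd
      have hPz := h0 z hz.2.1
      have hz' := hz
      simp only [Complex.mem_reProdIm, mem_Icc] at hz'
      obtain ⟨⟨h1, h2⟩, h3, h4⟩ := hz'
      rw [hbval]
      rcases hbd with h | h | h | h
      · have : z.im * (1 - 3 * (z.re - x₀) ^ 2 + z.im ^ 2) ≤ 0 :=
          mul_nonpos_of_nonneg_of_nonpos h3 (by rw [h]; nlinarith)
        nlinarith
      · have : z.im * (1 - 3 * (z.re - x₀) ^ 2 + z.im ^ 2) ≤ 0 :=
          mul_nonpos_of_nonneg_of_nonpos h3 (by rw [h]; nlinarith)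
        nlinarith
      · rw [h]; simpa using hPz
      · have hmz : m ≤ P z := hmin ⟨hz.1, h⟩
        rw [h]
        nlinarith [mul_nonneg hmpos.le (sq_nonneg (z.re - x₀))]
  refine ⟨m / 2, by positivity, fun y hy => ?_⟩
  have h := key ⟨x₀, y⟩ ⟨by simp, hy⟩
  rw [hbval] at h
  simp only [sub_self] at h
  have : 0 ≤ m / 2 * y ^ 3 := by have := hy.1; positivity
  nlinarith

/-- Derivative bound from a one-sided linear bound. -/
lemma deriv_le_of_le_mul {g : ℝ → ℝ} {g' c δ : ℝ} (hδ : 0 < δ) (hg : HasDerivAt g g' 0)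
    (h0 : g 0 = 0) (hle : ∀ x ∈ Icc 0 δ, g x ≤ c * x) : g' ≤ c := by
  refine le_of_tendsto hg.tendsto_slope_zero_right ?_
  filter_upwards [Ioc_mem_nhdsGT hδ] with t ht
  rw [zero_add, h0, sub_zero, smul_eq_mul, inv_mul_le_iff₀ ht.1, mul_comm]
  exact hle t ⟨ht.1.le, ht.2⟩

/-- If the boundary values of a harmonic function are stationary at a point, then its tangential
derivative tends to zero (here: is eventually at most `ε`) along the vertical line through it. -/
theorem exists_tangential_deriv_le {Q : ℂ → ℝ} (hQ : HarmonicOnNhd Q {z : ℂ | 0 < z.im})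
    (hc : ContinuousOn Q {z : ℂ | 0 ≤ z.im}) {x₀ : ℝ}
    (hd : HasDerivAt (fun x : ℝ => Q ⟨x, 0⟩) 0 x₀) {ε : ℝ} (hε : 0 < ε) :
    ∃ δ > 0, ∀ y ∈ Ioo 0 δ, fderiv ℝ Q ⟨x₀, y⟩ 1 ≤ ε := by
  -- The odd part about the line `x = x₀` vanishes on that line, and its `x`-derivative there is `2
  -- Q_x`.
  set R : ℂ → ℝ := fun z => Q (z + x₀) - Q ⟨-z.re + x₀, z.im⟩ with hR
  have hRharm : HarmonicOnNhd R {z : ℂ | 0 < z.im} := fun z hz => by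
    refine HarmonicAt.sub (f₁ := fun z : ℂ => Q (z + x₀))
      (f₂ := fun z : ℂ => Q ⟨-z.re + x₀, z.im⟩) ?_ ?_
    · exact HarmonicAt.comp_analyticAt (hQ _ (by simpa using hz)) (by fun_prop)
    · have h1 : HarmonicAt (fun w : ℂ => Q (w + x₀)) ⟨-z.re, z.im⟩ :=
        HarmonicAt.comp_analyticAt (hQ _ (by simpa using hz)) (by fun_prop)
      have h2 := HarmonicAt.comp_reflection h1
      refine (harmonicAt_congr_nhds (Eventually.of_forall fun w => ?_)).1 h2
      congr 1
      apply Complex.ext <;> simp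
  have hRcont : ContinuousOn R {z : ℂ | 0 ≤ z.im} := by
    refine ContinuousOn.sub (hc.comp (by fun_prop) fun z hz => by simpa using hz)
      (hc.comp (Continuous.continuousOn ?_) fun z hz => by simpa using hz)
    have : (fun z : ℂ => (⟨-z.re + x₀, z.im⟩ : ℂ)) = fun z : ℂ => -(starRingEnd ℂ z) + x₀ := by
      ext z; apply Complex.ext <;> simp
    rw [this]
    exact (Complex.continuous_conj.neg).add continuous_const
  -- the boundary values of the odd part `R` are `o(x)`
  obtain ⟨δ, hδ, hbdry⟩ : ∃ δ > 0, ∀ x ∈ Icc 0 δ, R ⟨x, 0⟩ ≤ 2 * (ε / 3) * x := by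
    have h1 := (hasDerivAt_iff_isLittleO.1 hd).def (c := ε / 3) (by positivity)
    obtain ⟨r, hr, hr'⟩ := Metric.eventually_nhds_iff.1 h1
    refine ⟨r / 2, by positivity, fun x hx => ?_⟩
    have e1 := hr' (y := x₀ + x) (by
      rw [Real.dist_eq, add_sub_cancel_left, abs_of_nonneg hx.1]; linarith [hx.2])
    have e2 := hr' (y := x₀ - x) (by
      rw [Real.dist_eq, sub_sub_cancel_left, abs_neg, abs_of_nonneg hx.1]; linarith [hx.2])
    simp only [smul_zero, sub_zero, Real.norm_eq_abs, add_sub_cancel_left, sub_sub_cancel_left,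
      abs_neg, abs_of_nonneg hx.1] at e1 e2
    have e3 := (abs_le.1 e1).2
    have e4 := (abs_le.1 e2).1
    have e5 : R ⟨x, 0⟩ = Q ⟨x₀ + x, 0⟩ - Q ⟨x₀ - x, 0⟩ := by
      simp only [hR]
      congr 2 <;> apply Complex.ext <;> simp <;> ring
    rw [e5]; linarith
  have hRzero : ∀ y, R ⟨0, y⟩ = 0 := fun y => by
    simp only [hR, sub_eq_zero]
    congr 1
    apply Complex.ext <;> simp
  have hvert : ∀ x : ℝ, ContinuousOn (fun y : ℝ => R ⟨x, y⟩) (Ici 0) := fun x =>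
    hRcont.comp (continuous_mk_right x).continuousOn fun y hy => hy
  -- Near the corner the strict gap between `2ε/3` and `ε` suffices; higher up, a steep slope in `y`
  -- dominates the bound of `R`.
  obtain ⟨K₁, hK₁, hside⟩ : ∃ K₁ ≥ 0, ∀ y ∈ Icc 0 δ,
      R ⟨δ, y⟩ ≤ ε * δ + K₁ * δ * y := by
    have h1 : ∀ᶠ y in 𝓝[≥] (0 : ℝ), R ⟨δ, y⟩ < ε * δ :=
      (hvert δ 0 self_mem_Ici).eventually_lt continuousWithinAt_const (by
        have := hbdry δ ⟨hδ.le, le_rfl⟩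
        have : 0 < ε * δ := by positivity
        linarith)
    obtain ⟨y₀, hy₀, hy₀'⟩ := mem_nhdsGE_iff_exists_Ico_subset.1 h1
    have hy₀pos : 0 < y₀ := hy₀
    obtain ⟨B, hB⟩ := (isCompact_Icc (a := (0 : ℝ)) (b := δ)).exists_bound_of_continuousOn
      ((hvert δ).mono Icc_subset_Ici_self)
    have hB0 : 0 ≤ B := (norm_nonneg _).trans (hB 0 ⟨le_rfl, hδ.le⟩)
    refine ⟨B / (δ * y₀), by positivity, fun y hy => ?_⟩
    have h0 : 0 ≤ B / (δ * y₀) * δ * y := by have := hy.1; positivity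
    by_cases hlt : y < y₀
    · have := hy₀' ⟨hy.1, hlt⟩
      simp only [mem_ofPred_eq] at this
      linarith
    · have h2 := (Real.le_norm_self _).trans (hB y hy)
      have h3 : B ≤ B / (δ * y₀) * δ * y := by
        have : B / (δ * y₀) * δ * y = B * (y / y₀) := by field_simp
        rw [this]
        exact le_mul_of_one_le_right hB0 ((one_le_div hy₀pos).2 (not_lt.1 hlt))
      have : 0 < ε * δ := by positivity
      linarith
  -- The top side lies in the open half-plane, where `R` is smooth, hence Lipschitz in `x`, and `R`
  -- vanishes at `x = 0`.
  obtain ⟨K₂, hK₂, htop⟩ : ∃ K₂ ≥ 0, ∀ x ∈ Icc 0 δ, R ⟨x, δ⟩ ≤ K₂ * δ * x := by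
    have hline : ContDiff ℝ 1 (fun x : ℝ => (⟨x, δ⟩ : ℂ)) := by
      have : (fun x : ℝ => (⟨x, δ⟩ : ℂ)) = fun x : ℝ => Complex.ofRealCLM x + δ * Complex.I := by
        ext y; apply Complex.ext <;> simp
      rw [this]
      exact Complex.ofRealCLM.contDiff.add contDiff_const
    have hs : ContDiffOn ℝ 1 (fun x : ℝ => R ⟨x, δ⟩) (Icc 0 δ) := fun x _ => by
      have := ((hRharm ⟨x, δ⟩ hδ).1.of_le (m := 1) (by norm_num)).comp x hline.contDiffAt
      exact this.contDiffWithinAt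
    obtain ⟨K, hK⟩ := hs.exists_lipschitzOnWith one_ne_zero (convex_Icc 0 δ) isCompact_Icc
    refine ⟨K / δ, by positivity, fun x hx => ?_⟩
    have := hK.dist_le_mul x hx 0 ⟨le_rfl, hδ.le⟩
    rw [hRzero, Real.dist_eq, Real.dist_eq, sub_zero, sub_zero, abs_of_nonneg hx.1] at this
    rw [div_mul_cancel₀ _ hδ.ne']
    exact (le_abs_self _).trans this
  set K := K₁ + K₂ with hK
  have hxy : ∀ z : ℂ, (z ^ 2).im = 2 * (z.re * z.im) := fun z => by
    rw [sq, Complex.mul_im]; ring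
  -- The harmonic barrier is `ε x + K x y`, since `Im z² = 2 x y`.
  have key : ∀ z ∈ Icc (0 : ℝ) δ ×ℂ Icc (0 : ℝ) δ,
      R z - (ε * z.re + K / 2 * (z ^ 2).im) ≤ 0 := by
    refine le_of_rect (u := fun z => R z - (ε * z.re + K / 2 * (z ^ 2).im)) hδ hδ ?_ ?_ ?_
    · intro z hz
      have h1 : HarmonicAt (fun z : ℂ => z.re) z :=
        AnalyticAt.harmonicAt_re (f := fun z : ℂ => z) (by fun_prop)
      have h2 : HarmonicAt (fun z : ℂ => (z ^ 2).im) z :=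
        AnalyticAt.harmonicAt_im (f := fun z : ℂ => z ^ 2) (by fun_prop)
      exact (hRharm z hz.2.1).sub ((h1.const_smul (c := ε)).add (h2.const_smul (c := K / 2)))
    · refine ContinuousOn.sub (hRcont.mono fun z hz => hz.2.1) (Continuous.continuousOn ?_)
      fun_prop
    · rintro ⟨x, y⟩ hz hbd
      simp only [Complex.mem_reProdIm, mem_Icc] at hz
      obtain ⟨⟨h1, h2⟩, h3, h4⟩ := hz
      simp only [hxy] at hbd ⊢
      have p1 : 0 ≤ K₁ * (x * y) := by positivity
      have p2 : 0 ≤ K₂ * (x * y) := by positivity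
      have p3 : 0 ≤ ε * x := by positivity
      have hKe : K / 2 * (2 * (x * y)) = K₁ * (x * y) + K₂ * (x * y) := by rw [hK]; ring
      rw [hKe]
      rcases hbd with h | h | h | h
      · subst h; rw [hRzero]; linarith
      · subst h
        have := hside y ⟨h3, h4⟩
        nlinarith
      · subst h
        have := hbdry x ⟨h1, h2⟩
        nlinarith
      · subst h
        have := htop x ⟨h1, h2⟩
        nlinarith
  have hderiv : ∀ y ∈ Ioo 0 δ, 2 * fderiv ℝ Q ⟨x₀, y⟩ 1 ≤ ε + K * y := by
    intro y hy
    have hdiff : DifferentiableAt ℝ Q ⟨x₀, y⟩ :=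
      (hQ ⟨x₀, y⟩ hy.1).1.differentiableAt (by norm_num)
    have hl : ∀ σ : ℝ, HasDerivAt (fun x : ℝ => (⟨σ * x + x₀, y⟩ : ℂ)) (σ : ℂ) 0 := fun σ => by
      have : (fun x : ℝ => (⟨σ * x + x₀, y⟩ : ℂ)) =
          fun x : ℝ => (x : ℂ) * σ + (x₀ + y * Complex.I) := by
        ext x; apply Complex.ext <;> simp; ring
      rw [this]
      simpa using ((Complex.ofRealCLM.hasDerivAt (x := 0)).mul_const (σ : ℂ)).add_const
        (x₀ + y * Complex.I : ℂ)
    have hcomp : ∀ σ : ℝ, HasDerivAt (fun x : ℝ => Q ⟨σ * x + x₀, y⟩)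
        (fderiv ℝ Q ⟨x₀, y⟩ (σ : ℂ)) 0 := fun σ => by
      refine HasFDerivAt.comp_hasDerivAt (f := fun x : ℝ => (⟨σ * x + x₀, y⟩ : ℂ)) 0 ?_ (hl σ)
      simpa using hdiff.hasFDerivAt
    have hsub := (hcomp 1).sub (hcomp (-1))
    have hval : fderiv ℝ Q ⟨x₀, y⟩ ((1 : ℝ) : ℂ) - fderiv ℝ Q ⟨x₀, y⟩ ((-1 : ℝ) : ℂ) =
        2 * fderiv ℝ Q ⟨x₀, y⟩ 1 := by
      push_cast
      rw [map_neg]; ring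
    rw [hval] at hsub
    refine deriv_le_of_le_mul hδ hsub (by simp) fun x hx => ?_
    have := key ⟨x, y⟩ ⟨hx, hy.1.le, hy.2.le⟩
    simp only [hxy, hR] at this
    have e1 : (⟨x, y⟩ + x₀ : ℂ) = ⟨1 * x + x₀, y⟩ := by apply Complex.ext <;> simp
    have e2 : (⟨-x + x₀, y⟩ : ℂ) = ⟨-1 * x + x₀, y⟩ := by apply Complex.ext <;> simp
    rw [e1, e2] at this
    simp only [Pi.sub_apply]
    linarith
  have hKnn : 0 ≤ K := add_nonneg hK₁ hK₂
  -- This height makes `K y < ε`, so `2 Q_x ≤ ε + K y` yields `Q_x ≤ ε`.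
  refine ⟨min δ (ε / (K + 1)), by positivity, fun y hy => ?_⟩
  have h1 := hderiv y ⟨hy.1, hy.2.trans_le (min_le_left _ _)⟩
  have h2 : y * (K + 1) < ε := by
    rw [← lt_div_iff₀ (by positivity)]
    exact hy.2.trans_le (min_le_right _ _)
  have := hy.1
  nlinarith

/-! ### First derivatives of solutions up to the boundary -/

/-- The tangential derivative of `V`, up to the boundary of the half-plane. -/
noncomputable def dx (V : ℂ → ℝ) (z : ℂ) : ℝ := fderivWithin ℝ V {z : ℂ | 0 ≤ z.im} z 1

/-- The normal derivative of `V`, up to the boundary of the half-plane. -/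
noncomputable def dy (V : ℂ → ℝ) (z : ℂ) : ℝ := fderivWithin ℝ V {z : ℂ | 0 ≤ z.im} z Complex.I

/-- The complex gradient `V_x - i V_y`. -/
noncomputable def cgrad (V : ℂ → ℝ) (z : ℂ) : ℂ := dx V z - Complex.I * dy V z

lemma cgrad_re (V : ℂ → ℝ) (z : ℂ) : (cgrad V z).re = dx V z := by simp [cgrad]

lemma cgrad_im (V : ℂ → ℝ) (z : ℂ) : (cgrad V z).im = -dy V z := by simp [cgrad]

lemma upper_mem_nhds {z : ℂ} (hz : 0 < z.im) : {z : ℂ | 0 ≤ z.im} ∈ 𝓝 z :=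
  mem_of_superset (isOpen_upper.mem_nhds hz) fun w (hw : 0 < w.im) => hw.le

lemma uniqueDiffOn_upper : UniqueDiffOn ℝ {z : ℂ | 0 ≤ z.im} := by
  refine uniqueDiffOn_convex (convex_halfSpace_im_ge 0) ⟨Complex.I, ?_⟩
  exact mem_interior_iff_mem_nhds.2 (upper_mem_nhds (by simp))

lemma hasDerivAt_mk_left (x y : ℝ) : HasDerivAt (fun t : ℝ => (⟨t, y⟩ : ℂ)) 1 x := by
  have : (fun t : ℝ => (⟨t, y⟩ : ℂ)) = fun t : ℝ => Complex.ofRealCLM t + y * Complex.I := by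
    funext t; apply Complex.ext <;> simp
  rw [this]
  simpa using (Complex.ofRealCLM.hasDerivAt (x := x)).add_const (y * Complex.I : ℂ)

lemma hasDerivAt_mk_right (x y : ℝ) : HasDerivAt (fun t : ℝ => (⟨x, t⟩ : ℂ)) Complex.I y := by
  have : (fun t : ℝ => (⟨x, t⟩ : ℂ)) = fun t : ℝ => x + Complex.ofRealCLM t * Complex.I := by
    funext t; apply Complex.ext <;> simp
  rw [this]
  simpa using ((Complex.ofRealCLM.hasDerivAt (x := y)).mul_const Complex.I).const_add (x : ℂ)

namespace IsSolution

variable {f : ℝ → ℝ} {V : ℂ → ℝ}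

lemma continuousOn (hV : IsSolution f V) : ContinuousOn V {z : ℂ | 0 ≤ z.im} :=
  hV.contDiffOn.continuousOn

lemma continuous_boundary (hV : IsSolution f V) : Continuous fun x : ℝ => V ⟨x, 0⟩ :=
  hV.continuousOn.comp_continuous (continuous_mk_left 0) fun _ => by simp

lemma hasFDerivWithinAt (hV : IsSolution f V) {z : ℂ} (hz : 0 ≤ z.im) :
    HasFDerivWithinAt V (fderivWithin ℝ V {z : ℂ | 0 ≤ z.im} z) {z : ℂ | 0 ≤ z.im} z :=
  (hV.contDiffOn.differentiableOn one_ne_zero z hz).hasFDerivWithinAt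

lemma hasFDerivAt (hV : IsSolution f V) {z : ℂ} (hz : 0 < z.im) :
    HasFDerivAt V (fderivWithin ℝ V {z : ℂ | 0 ≤ z.im} z) z :=
  (hV.hasFDerivWithinAt hz.le).hasFDerivAt (upper_mem_nhds hz)

lemma continuousOn_dx (hV : IsSolution f V) : ContinuousOn (dx V) {z : ℂ | 0 ≤ z.im} :=
  (hV.contDiffOn.continuousOn_fderivWithin uniqueDiffOn_upper le_rfl).clm_apply continuousOn_const

lemma continuousOn_dy (hV : IsSolution f V) : ContinuousOn (dy V) {z : ℂ | 0 ≤ z.im} :=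
  (hV.contDiffOn.continuousOn_fderivWithin uniqueDiffOn_upper le_rfl).clm_apply continuousOn_const

lemma continuousOn_cgrad (hV : IsSolution f V) : ContinuousOn (cgrad V) {z : ℂ | 0 ≤ z.im} :=
  (Complex.continuous_ofReal.comp_continuousOn hV.continuousOn_dx).sub
    (continuousOn_const.mul (Complex.continuous_ofReal.comp_continuousOn hV.continuousOn_dy))

/-- Harmonicity of `V` amounts to the Cauchy–Riemann equations for `V_x - i V_y`. Harmonicity of
both partial derivatives and the integral identities rest on this. -/
lemma analyticAt_cgrad (hV : IsSolution f V) {z : ℂ} (hz : 0 < z.im) :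
    AnalyticAt ℂ (cgrad V) z := by
  refine (HarmonicAt.analyticAt_complex_partial (hV.harmonic z hz)).congr ?_
  filter_upwards [isOpen_upper.mem_nhds hz] with w hw
  simp only [cgrad, dx, dy]
  rw [fderivWithin_of_mem_nhds (upper_mem_nhds hw)]

lemma harmonic_dx (hV : IsSolution f V) : HarmonicOnNhd (dx V) {z : ℂ | 0 < z.im} := fun z hz => by
  simpa only [cgrad_re] using (hV.analyticAt_cgrad hz).harmonicAt_re

lemma harmonic_dy (hV : IsSolution f V) : HarmonicOnNhd (dy V) {z : ℂ | 0 < z.im} := fun z hz => by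
  have := (hV.analyticAt_cgrad hz).harmonicAt_im.neg
  refine (harmonicAt_congr_nhds (Eventually.of_forall fun w => ?_)).1 this
  simp [cgrad_im]

lemma hasDerivAt_horizontal (hV : IsSolution f V) (x : ℝ) {y : ℝ} (hy : 0 ≤ y) :
    HasDerivAt (fun t : ℝ => V ⟨t, y⟩) (dx V ⟨x, y⟩) x :=
  (hV.hasFDerivWithinAt (z := ⟨x, y⟩) hy).comp_hasDerivAt x
    (hasDerivAt_mk_left x y) (Eventually.of_forall fun _ => hy)

lemma hasDerivAt_vertical (hV : IsSolution f V) (x : ℝ) :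
    HasDerivWithinAt (fun t : ℝ => V ⟨x, t⟩) (dy V ⟨x, 0⟩) (Ici 0) 0 :=
  (hV.hasFDerivWithinAt (z := ⟨x, 0⟩) le_rfl).comp_hasDerivWithinAt 0
    (hasDerivAt_mk_right x 0).hasDerivWithinAt fun _ ht => ht

lemma dy_boundary (hV : IsSolution f V) (x : ℝ) : dy V ⟨x, 0⟩ = -f (V ⟨x, 0⟩) :=
  (uniqueDiffOn_Ici (0 : ℝ) 0 self_mem_Ici).eq_deriv _ (hV.hasDerivAt_vertical x) (hV.boundary x)

/-- Nothing is assumed about `f`: the boundary condition identifies this function with `-V_y`, which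
is continuous up to the boundary. -/
lemma continuous_reaction (hV : IsSolution f V) : Continuous fun x : ℝ => f (V ⟨x, 0⟩) := by
  have h : Continuous fun x : ℝ => -dy V ⟨x, 0⟩ :=
    (hV.continuousOn_dy.comp_continuous (continuous_mk_left 0) fun _ => by simp).neg
  simpa only [hV.dy_boundary, neg_neg] using h

/-- The mixed derivatives agree by Cauchy–Riemann for the complex gradient. A bound on the
tangential derivative of `V_y` thus controls the vertical growth of `V_x`. -/
lemma hasDerivAt_dx_vertical (hV : IsSolution f V) (x : ℝ) {y : ℝ} (hy : 0 < y) :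
    HasDerivAt (fun t : ℝ => dx V ⟨x, t⟩) (fderiv ℝ (dy V) ⟨x, y⟩ 1) y := by
  set z : ℂ := ⟨x, y⟩
  have hF := (hV.analyticAt_cgrad (z := z) hy).differentiableAt.hasFDerivAt.restrictScalars ℝ
  set L := fderiv ℂ (cgrad V) z
  have hre : HasFDerivAt (dx V) (Complex.reCLM ∘L L.restrictScalars ℝ) z := by
    have := Complex.reCLM.hasFDerivAt.comp z hF
    simpa only [Function.comp_def, Complex.reCLM_apply, cgrad_re] using this
  have him : HasFDerivAt (dy V) (-(Complex.imCLM ∘L L.restrictScalars ℝ)) z := by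
    have := (Complex.imCLM.hasFDerivAt.comp z hF).neg
    refine this.congr_of_eventuallyEq (Eventually.of_forall fun w => ?_)
    simp [cgrad_im]
  have h1 := hre.comp_hasDerivAt y (hasDerivAt_mk_right x y)
  refine h1.congr_deriv ?_
  rw [him.fderiv]
  have hI : L Complex.I = Complex.I * L 1 := by
    rw [← smul_eq_mul, ← map_smul, smul_eq_mul, mul_one]
  simp [hI]

lemma translate (hV : IsSolution f V) (b : ℝ) : IsSolution f fun z => V (z + b) := by
  have hadd : ∀ x y : ℝ, (⟨x, y⟩ + b : ℂ) = ⟨x + b, y⟩ := fun x y => by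
    apply Complex.ext <;> simp
  refine ⟨hV.contDiffOn.comp (by fun_prop) fun z hz => by simpa using hz, fun z hz => ?_,
    fun x => ?_, fun z hz => hV.mem_Icc _ (by simpa using hz)⟩
  · exact HarmonicAt.comp_analyticAt (hV.harmonic _ (by simpa using hz)) (by fun_prop)
  · simpa only [hadd] using hV.boundary (x + b)

lemma reflect (hV : IsSolution f V) : IsSolution f fun z => V ⟨-z.re, z.im⟩ := by
  refine ⟨hV.contDiffOn.comp (ContDiff.contDiffOn ?_) fun z hz => hz, fun z hz => ?_,
    fun x => ?_, fun z hz => hV.mem_Icc _ hz⟩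
  · have : (fun z : ℂ => (⟨-z.re, z.im⟩ : ℂ)) = fun z => -(Complex.conjCLE z) := by
      funext z; apply Complex.ext <;> simp
    rw [this]
    exact Complex.conjCLE.contDiff.neg
  · exact HarmonicAt.comp_reflection (hV.harmonic ⟨-z.re, z.im⟩ hz)
  · exact hV.boundary (-x)

/-- A solution with constant boundary values is constant. -/
lemma eq_const (hV : IsSolution f V) {e : ℝ} (he : ∀ x : ℝ, V ⟨x, 0⟩ = e) {z : ℂ}
    (hz : 0 ≤ z.im) : V z = e :=
  le_antisymm
    (le_of_boundary_le hV.harmonic hV.continuousOn (fun z hz => (hV.mem_Icc z hz).2)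
      (fun x => (he x).le) z hz)
    (ge_of_boundary_ge hV.harmonic hV.continuousOn (fun z hz => (hV.mem_Icc z hz).1)
      (fun x => (he x).ge) z hz)

end IsSolution

/-! ### Integral identities in logarithmic coordinates

The exponential maps the strip `0 ≤ Im w ≤ π` to the closed half-plane. -/

/-- The complex gradient of `V ∘ exp`. -/
noncomputable def stripGrad (V : ℂ → ℝ) (w : ℂ) : ℂ := Complex.exp w * cgrad V (Complex.exp w)

lemma exp_im_nonneg {w : ℂ} (hw : w.im ∈ Icc 0 Real.pi) : 0 ≤ (Complex.exp w).im := by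
  rw [Complex.exp_im]
  exact mul_nonneg (Real.exp_pos _).le (Real.sin_nonneg_of_mem_Icc hw)

lemma exp_im_pos {w : ℂ} (hw : w.im ∈ Ioo 0 Real.pi) : 0 < (Complex.exp w).im := by
  rw [Complex.exp_im]
  exact mul_pos (Real.exp_pos _) (Real.sin_pos_of_mem_Ioo hw)

lemma exp_top (s : ℝ) : Complex.exp (s + Real.pi * Complex.I) = ⟨-Real.exp s, 0⟩ := by
  rw [Complex.exp_add, Complex.exp_pi_mul_I]
  apply Complex.ext <;> simp [Complex.exp_ofReal_re, Complex.exp_ofReal_im]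

lemma exp_bottom (s : ℝ) : Complex.exp s = ⟨Real.exp s, 0⟩ := by
  rw [← Complex.ofReal_exp]; rfl

lemma continuousOn_vertical {E : Type*} [TopologicalSpace E] {g : ℂ → E}
    (hg : ContinuousOn g {w : ℂ | w.im ∈ Icc 0 Real.pi}) (s : ℝ) :
    ContinuousOn (fun y : ℝ => g (s + y * Complex.I)) (uIcc 0 Real.pi) := by
  rw [uIcc_of_le Real.pi_pos.le]
  exact hg.comp (Continuous.continuousOn (by fun_prop)) fun y hy => by simpa using hy

lemma continuous_bottom {E : Type*} [TopologicalSpace E] {g : ℂ → E}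
    (hg : ContinuousOn g {w : ℂ | w.im ∈ Icc 0 Real.pi}) :
    Continuous fun s : ℝ => g s :=
  hg.comp_continuous Complex.continuous_ofReal fun s => by simp [Real.pi_pos.le]

lemma continuous_top {E : Type*} [TopologicalSpace E] {g : ℂ → E}
    (hg : ContinuousOn g {w : ℂ | w.im ∈ Icc 0 Real.pi}) :
    Continuous fun s : ℝ => g (s + Real.pi * Complex.I) :=
  hg.comp_continuous (by fun_prop) fun s => by simp [Real.pi_pos.le]

lemma continuous_integral_vertical {g : ℂ → ℝ}
    (hg : ContinuousOn g {w : ℂ | w.im ∈ Icc 0 Real.pi}) :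
    Continuous fun s : ℝ => ∫ y in (0 : ℝ)..Real.pi, g (s + y * Complex.I) := by
  -- Clamping `y` to `[0, π]` extends the integrand continuously to the whole plane without changing
  -- the integral.
  have hclamp : Continuous fun p : ℝ × ℝ =>
      g (p.1 + ((projIcc 0 Real.pi Real.pi_pos.le p.2 : ℝ) : ℂ) * Complex.I) := by
    refine hg.comp_continuous ?_ fun p => ?_
    · have : Continuous fun p : ℝ × ℝ => (projIcc 0 Real.pi Real.pi_pos.le p.2 : ℝ) :=
        continuous_subtype_val.comp (continuous_projIcc.comp continuous_snd)
      fun_prop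
    · have := (projIcc 0 Real.pi Real.pi_pos.le p.2).2
      simpa only [mem_ofPred_eq, Complex.add_im, Complex.ofReal_im, Complex.mul_im, Complex.I_im,
        Complex.I_re, mul_one, mul_zero, add_zero, zero_add, Complex.ofReal_re] using this
  have h := intervalIntegral.continuous_parametric_intervalIntegral_of_continuous'
    (μ := MeasureTheory.volume) (f := fun (s : ℝ) (y : ℝ) =>
      g (s + ((projIcc 0 Real.pi Real.pi_pos.le y : ℝ) : ℂ) * Complex.I)) hclamp 0 Real.pi
  refine h.congr fun s => intervalIntegral.integral_congr fun y hy => ?_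
  rw [uIcc_of_le Real.pi_pos.le] at hy
  simp only [projIcc_of_mem Real.pi_pos.le hy]

/-- The imaginary part of a contour integral over the boundary of a rectangle in the strip. -/
lemma im_boundary_integral {φ : ℂ → ℂ} (hφ : ContinuousOn φ {w : ℂ | w.im ∈ Icc 0 Real.pi})
    (s₁ s₂ : ℝ) :
    ((∫ s : ℝ in s₁..s₂, φ s) - (∫ s : ℝ in s₁..s₂, φ (s + Real.pi * Complex.I)) +
      Complex.I • (∫ y : ℝ in (0 : ℝ)..Real.pi, φ (s₂ + y * Complex.I)) -
      Complex.I • ∫ y : ℝ in (0 : ℝ)..Real.pi, φ (s₁ + y * Complex.I)).im =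
    (∫ s : ℝ in s₁..s₂, (φ s).im) - (∫ s : ℝ in s₁..s₂, (φ (s + Real.pi * Complex.I)).im) +
      (∫ y : ℝ in (0 : ℝ)..Real.pi, (φ (s₂ + y * Complex.I)).re) -
      ∫ y : ℝ in (0 : ℝ)..Real.pi, (φ (s₁ + y * Complex.I)).re := by
  have him : ∀ {g : ℝ → ℂ} {a b : ℝ}, IntervalIntegrable g MeasureTheory.volume a b →
      (∫ x in a..b, g x).im = ∫ x in a..b, (g x).im := fun h =>
    (Complex.imCLM.intervalIntegral_comp_comm h).symm
  have hre : ∀ {g : ℝ → ℂ} {a b : ℝ}, IntervalIntegrable g MeasureTheory.volume a b →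
      (∫ x in a..b, g x).re = ∫ x in a..b, (g x).re := fun h =>
    (Complex.reCLM.intervalIntegral_comp_comm h).symm
  have hver : ∀ s : ℝ, IntervalIntegrable (fun y : ℝ => φ (s + y * Complex.I))
    MeasureTheory.volume 0 Real.pi := fun s => (continuousOn_vertical hφ s).intervalIntegrable
  rw [← him ((continuous_bottom hφ).intervalIntegrable _ _),
    ← him ((continuous_top hφ).intervalIntegrable _ _), ← hre (hver s₁), ← hre (hver s₂)]
  simp

lemma rect_subset_strip (s₁ s₂ : ℝ) :
    (uIcc s₁ s₂ ×ℂ uIcc 0 Real.pi) ⊆ {w : ℂ | w.im ∈ Icc 0 Real.pi} := fun w hw => by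
  have := hw.2
  rwa [uIcc_of_le Real.pi_pos.le] at this

namespace IsSolution

variable {f : ℝ → ℝ} {V : ℂ → ℝ}

lemma fderivWithin_apply (V : ℂ → ℝ) (z h : ℂ) :
    fderivWithin ℝ V {z : ℂ | 0 ≤ z.im} z h = dx V z * h.re + dy V z * h.im := by
  have hh : h = h.re • (1 : ℂ) + h.im • Complex.I := by apply Complex.ext <;> simp
  conv_lhs => rw [hh]
  rw [map_add, map_smul, map_smul]
  simp only [smul_eq_mul, dx, dy]
  ring

lemma continuousOn_comp_exp (hV : IsSolution f V) :
    ContinuousOn (fun w => V (Complex.exp w)) {w : ℂ | w.im ∈ Icc 0 Real.pi} :=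
  hV.continuousOn.comp Complex.continuous_exp.continuousOn fun _ hw => exp_im_nonneg hw

lemma continuousOn_stripGrad (hV : IsSolution f V) :
    ContinuousOn (stripGrad V) {w : ℂ | w.im ∈ Icc 0 Real.pi} :=
  Complex.continuous_exp.continuousOn.mul
    (hV.continuousOn_cgrad.comp Complex.continuous_exp.continuousOn fun _ hw => exp_im_nonneg hw)

lemma differentiableAt_stripGrad (hV : IsSolution f V) {w : ℂ} (hw : w.im ∈ Ioo 0 Real.pi) :
    DifferentiableAt ℂ (stripGrad V) w :=
  Complex.differentiable_exp.differentiableAt.mul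
    ((hV.analyticAt_cgrad (exp_im_pos hw)).differentiableAt.comp w
      Complex.differentiable_exp.differentiableAt)

lemma stripGrad_bottom_re (V : ℂ → ℝ) (s : ℝ) :
    (stripGrad V s).re = Real.exp s * dx V ⟨Real.exp s, 0⟩ := by
  rw [stripGrad, exp_bottom]
  simp [cgrad_re, cgrad_im]

lemma stripGrad_bottom_im (hV : IsSolution f V) (s : ℝ) :
    (stripGrad V s).im = Real.exp s * f (V ⟨Real.exp s, 0⟩) := by
  rw [stripGrad, exp_bottom]
  simp [cgrad_re, cgrad_im, hV.dy_boundary]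

lemma stripGrad_top_re (V : ℂ → ℝ) (s : ℝ) :
    (stripGrad V (s + Real.pi * Complex.I)).re = -(Real.exp s * dx V ⟨-Real.exp s, 0⟩) := by
  rw [stripGrad, exp_top]
  simp [cgrad_re, cgrad_im]

lemma stripGrad_top_im (hV : IsSolution f V) (s : ℝ) :
    (stripGrad V (s + Real.pi * Complex.I)).im = -(Real.exp s * f (V ⟨-Real.exp s, 0⟩)) := by
  rw [stripGrad, exp_top]
  simp [cgrad_re, cgrad_im, hV.dy_boundary]

lemma continuousOn_normSq_stripGrad (hV : IsSolution f V) :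
    ContinuousOn (fun w => Complex.normSq (stripGrad V w)) {w : ℂ | w.im ∈ Icc 0 Real.pi} :=
  Complex.continuous_normSq.comp_continuousOn hV.continuousOn_stripGrad

/-- Testing the equation with `V - e` on a half-annulus. -/
theorem energy_identity (hV : IsSolution f V) (e s₁ s₂ : ℝ) :
    (∫ y in (0 : ℝ)..Real.pi, (V (Complex.exp (s₂ + y * Complex.I)) - e) *
        (stripGrad V (s₂ + y * Complex.I)).re) -
      ∫ y in (0 : ℝ)..Real.pi, (V (Complex.exp (s₁ + y * Complex.I)) - e) *
        (stripGrad V (s₁ + y * Complex.I)).re =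
    ∫ s in s₁..s₂, ((∫ y in (0 : ℝ)..Real.pi, Complex.normSq (stripGrad V (s + y * Complex.I))) -
      Real.exp s * (f (V ⟨Real.exp s, 0⟩) * (V ⟨Real.exp s, 0⟩ - e) +
        f (V ⟨-Real.exp s, 0⟩) * (V ⟨-Real.exp s, 0⟩ - e))) := by
  set S : Set ℂ := {w : ℂ | w.im ∈ Icc 0 Real.pi} with hS
  set φ : ℂ → ℂ := fun w => (V (Complex.exp w) - e) • stripGrad V w with hφ
  set φ' : ℂ → ℂ →L[ℝ] ℂ := fun w =>
    (V (Complex.exp w) - e) • (fderiv ℂ (stripGrad V) w).restrictScalars ℝ +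
      ((fderivWithin ℝ V {z : ℂ | 0 ≤ z.im} (Complex.exp w)).comp
        ((Complex.exp w • (1 : ℂ →L[ℂ] ℂ)).restrictScalars ℝ)).smulRight (stripGrad V w) with hφ'
  have hφc : ContinuousOn φ S :=
    (hV.continuousOn_comp_exp.sub continuousOn_const).smul hV.continuousOn_stripGrad
  -- Let `Ψ` be the strip gradient. Its own derivative cancels because it is complex linear, and the
  -- factor `V ∘ exp` contributes `(i Re Ψ + Im Ψ) Ψ = i |Ψ|²`.
  have hdiv : ∀ w, Complex.I • φ' w 1 - φ' w Complex.I =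
      Complex.I * (Complex.normSq (stripGrad V w) : ℂ) := fun w => by
    have hI : fderiv ℂ (stripGrad V) w Complex.I = Complex.I * fderiv ℂ (stripGrad V) w 1 := by
      rw [← smul_eq_mul, ← map_smul, smul_eq_mul, mul_one]
    have h1 : (fderivWithin ℝ V {z : ℂ | 0 ≤ z.im} (Complex.exp w)) (Complex.exp w * 1) =
        (stripGrad V w).re := by
      rw [fderivWithin_apply, stripGrad, Complex.mul_re (Complex.exp w) (cgrad V _), cgrad_re,
        cgrad_im, mul_one]; ring
    have h2 : (fderivWithin ℝ V {z : ℂ | 0 ≤ z.im} (Complex.exp w)) (Complex.exp w * Complex.I) =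
        -(stripGrad V w).im := by
      rw [fderivWithin_apply, stripGrad, Complex.mul_im (Complex.exp w) (cgrad V _), cgrad_re,
        cgrad_im]
      simp only [Complex.mul_re, Complex.mul_im, Complex.I_re, Complex.I_im]
      ring
    simp only [hφ', add_apply, smul_apply,
      ContinuousLinearMap.coe_restrictScalars', ContinuousLinearMap.smulRight_apply,
      ContinuousLinearMap.comp_apply, one_apply_eq_self, smul_eq_mul, h1, h2, hI]
    apply Complex.ext <;> simp [Complex.normSq_apply] <;> ring
  have hid := Complex.integral_boundary_rect_of_continuousOn_of_hasFDerivAt_real φ φ'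
    (⟨s₁, 0⟩ : ℂ) ⟨s₂, Real.pi⟩ (hφc.mono (rect_subset_strip s₁ s₂)) ?_ ?_
  · simp only [hdiv, Complex.ofReal_zero, zero_mul, add_zero] at hid
    have hi := congrArg Complex.im hid
    rw [im_boundary_integral hφc] at hi
    have hrhs : (∫ s in s₁..s₂, ∫ y in (0 : ℝ)..Real.pi,
        Complex.I * (Complex.normSq (stripGrad V (s + y * Complex.I)) : ℂ)).im =
        ∫ s in s₁..s₂, ∫ y in (0 : ℝ)..Real.pi,
          Complex.normSq (stripGrad V (s + y * Complex.I)) := by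
      simp only [intervalIntegral.integral_const_mul, intervalIntegral.integral_ofReal]
      simp
    rw [hrhs] at hi
    have hb1 : Continuous fun s : ℝ => (φ s).im :=
      Complex.continuous_im.comp (continuous_bottom hφc)
    have hb2 : Continuous fun s : ℝ => (φ (s + Real.pi * Complex.I)).im :=
      Complex.continuous_im.comp (continuous_top hφc)
    have hb3 := continuous_integral_vertical hV.continuousOn_normSq_stripGrad
    have hre : ∀ w, (φ w).re = (V (Complex.exp w) - e) * (stripGrad V w).re := fun w => by
      simp [hφ]
    have him : ∀ w, (φ w).im = (V (Complex.exp w) - e) * (stripGrad V w).im := fun w => by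
      simp [hφ]
    have hsum : ∀ s : ℝ, (∫ y in (0 : ℝ)..Real.pi,
          Complex.normSq (stripGrad V (s + y * Complex.I))) -
        Real.exp s * (f (V ⟨Real.exp s, 0⟩) * (V ⟨Real.exp s, 0⟩ - e) +
        f (V ⟨-Real.exp s, 0⟩) * (V ⟨-Real.exp s, 0⟩ - e)) =
        (∫ y in (0 : ℝ)..Real.pi, Complex.normSq (stripGrad V (s + y * Complex.I))) -
          ((φ s).im - (φ (s + Real.pi * Complex.I)).im) := fun s => by
      rw [him, him, hV.stripGrad_bottom_im, hV.stripGrad_top_im, exp_bottom, exp_top]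
      ring
    simp only [hsum]
    have hb4 : Continuous fun s : ℝ => (φ s).im - (φ (s + Real.pi * Complex.I)).im := hb1.sub hb2
    rw [intervalIntegral.integral_sub (hb3.intervalIntegrable _ _) (hb4.intervalIntegrable _ _),
      intervalIntegral.integral_sub (hb1.intervalIntegrable _ _) (hb2.intervalIntegrable _ _)]
    simp only [hre] at hi
    linarith
  · intro w hw
    have hw' : w.im ∈ Ioo 0 Real.pi := by
      have := hw.2
      rwa [min_eq_left Real.pi_pos.le, max_eq_right Real.pi_pos.le] at this
    have h1 := (hV.differentiableAt_stripGrad hw').hasFDerivAt.restrictScalars ℝ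
    have h2 := (Complex.hasStrictDerivAt_exp w).hasDerivAt.hasFDerivAt.restrictScalars ℝ
    have h3 := ((hV.hasFDerivAt (exp_im_pos hw')).comp w h2).sub_const e
    have h4 := h3.smul h1
    refine h4.congr_fderiv ?_
    ext h
    simp only [hφ', mul_comm, add_apply, smul_apply, ContinuousLinearMap.coe_restrictScalars',
      ContinuousLinearMap.smulRight_apply, ContinuousLinearMap.comp_apply, one_apply_eq_self,
      ContinuousLinearMap.toSpanSingleton_apply, smul_eq_mul, Function.comp_apply]
  · simp only [hdiv]
    have hc : ContinuousOn (fun w => Complex.I * (Complex.normSq (stripGrad V w) : ℂ))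
        (uIcc s₁ s₂ ×ℂ uIcc 0 Real.pi) :=
      continuousOn_const.mul (Complex.continuous_ofReal.comp_continuousOn
        (hV.continuousOn_normSq_stripGrad.mono (rect_subset_strip s₁ s₂)))
    exact hc.integrableOn_compact (isCompact_uIcc.reProdIm isCompact_uIcc)

/-- The Pohozaev identity on a half-annulus. -/
theorem pohozaev_identity (hV : IsSolution f V) (s₁ s₂ : ℝ) :
    (∫ y in (0 : ℝ)..Real.pi, (stripGrad V (s₂ + y * Complex.I) ^ 2).re) -
      ∫ y in (0 : ℝ)..Real.pi, (stripGrad V (s₁ + y * Complex.I) ^ 2).re =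
    ∫ s in s₁..s₂, -2 * Real.exp s * (
      f (V ⟨Real.exp s, 0⟩) * (Real.exp s * dx V ⟨Real.exp s, 0⟩) +
      f (V ⟨-Real.exp s, 0⟩) * (-Real.exp s * dx V ⟨-Real.exp s, 0⟩)) := by
  -- Cauchy's theorem for this holomorphic square is the whole identity: on the horizontal sides its
  -- imaginary part is a product of `V_x` with `f(V)`.
  set φ : ℂ → ℂ := fun w => stripGrad V w ^ 2 with hφ
  have hφc : ContinuousOn φ {w : ℂ | w.im ∈ Icc 0 Real.pi} := hV.continuousOn_stripGrad.pow 2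
  have hid := Complex.integral_boundary_rect_eq_zero_of_continuousOn_of_differentiableOn φ
    (⟨s₁, 0⟩ : ℂ) ⟨s₂, Real.pi⟩ (hφc.mono (rect_subset_strip s₁ s₂)) fun w hw => by
      have hw' : w.im ∈ Ioo 0 Real.pi := by
        have := hw.2
        rwa [min_eq_left Real.pi_pos.le, max_eq_right Real.pi_pos.le] at this
      exact ((hV.differentiableAt_stripGrad hw').pow 2).differentiableWithinAt
  simp only [Complex.ofReal_zero, zero_mul, add_zero] at hid
  have hi := congrArg Complex.im hid
  rw [im_boundary_integral hφc, Complex.zero_im] at hi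
  have hb1 : Continuous fun s : ℝ => (φ s).im :=
    Complex.continuous_im.comp (continuous_bottom hφc)
  have hb2 : Continuous fun s : ℝ => (φ (s + Real.pi * Complex.I)).im :=
    Complex.continuous_im.comp (continuous_top hφc)
  have him : ∀ w, (φ w).im = 2 * ((stripGrad V w).re * (stripGrad V w).im) := fun w => by
    simp only [hφ, sq, Complex.mul_im]; ring
  have hsum : ∀ s : ℝ, -2 * Real.exp s * (
      f (V ⟨Real.exp s, 0⟩) * (Real.exp s * dx V ⟨Real.exp s, 0⟩) +
      f (V ⟨-Real.exp s, 0⟩) * (-Real.exp s * dx V ⟨-Real.exp s, 0⟩)) =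
      (φ (s + Real.pi * Complex.I)).im - (φ s).im := fun s => by
    rw [him, him, hV.stripGrad_bottom_im, hV.stripGrad_top_im, stripGrad_bottom_re,
      stripGrad_top_re]
    ring
  simp only [hsum]
  rw [intervalIntegral.integral_sub (hb2.intervalIntegrable _ _) (hb1.intervalIntegrable _ _)]
  linarith

end IsSolution

/-! ### Absence of homoclinic solutions -/

/-- Cauchy–Schwarz against the constant `1`, obtained by integrating the squared deviation of `φ`
from its mean. -/
lemma sq_integral_le {φ : ℝ → ℝ} {a b : ℝ} (hab : a < b) (hφ : ContinuousOn φ (uIcc a b)) :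
    (∫ y in a..b, φ y) ^ 2 ≤ (b - a) * ∫ y in a..b, φ y ^ 2 := by
  set J := ∫ y in a..b, φ y with hJ
  set m := J / (b - a) with hm
  have hba : 0 < b - a := sub_pos.2 hab
  have h0 : 0 ≤ ∫ y in a..b, (φ y - m) ^ 2 :=
    intervalIntegral.integral_nonneg hab.le fun y _ => sq_nonneg _
  have h1 : ∫ y in a..b, (φ y - m) ^ 2 =
      (∫ y in a..b, φ y ^ 2) - 2 * m * J + m ^ 2 * (b - a) := by
    have e : ∀ y, (φ y - m) ^ 2 = (φ y ^ 2 - 2 * m * φ y) + m ^ 2 := fun y => by ring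
    have i1 : IntervalIntegrable (fun y => φ y ^ 2) MeasureTheory.volume a b :=
      (hφ.pow 2).intervalIntegrable
    have i2 : IntervalIntegrable (fun y => 2 * m * φ y) MeasureTheory.volume a b :=
      (continuousOn_const.mul hφ).intervalIntegrable
    simp only [e]
    rw [intervalIntegral.integral_add (i1.sub i2) intervalIntegrable_const,
      intervalIntegral.integral_sub i1 i2, intervalIntegral.integral_const_mul,
      intervalIntegral.integral_const, smul_eq_mul]
    ring
  have h2 : m * (b - a) = J := div_mul_cancel₀ _ hba.ne'
  rw [h1] at h0
  nlinarith

/-- A function whose derivative dominates its square cannot have derivative bounded below by a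
positive constant on a half-line. -/
lemma exists_deriv_lt_of_sq_le {A h : ℝ → ℝ} {C ε S : ℝ} (hC : 0 < C) (hε : 0 < ε)
    (hA : ∀ s, HasDerivAt A (h s) s) (hsq : ∀ s ≥ S, A s ^ 2 ≤ C * h s) :
    ∃ s ≥ S, h s < ε := by
  by_contra! hge
  -- A derivative at least `ε` forces linear growth, so eventually `A ≥ 1` and dividing by `A²` is
  -- allowed.
  have hlin : ∀ s ≥ S, A S + ε * (s - S) ≤ A s := by
    intro s hs
    have hmono : MonotoneOn (fun s => A s - ε * s) (Ici S) := by
      refine monotoneOn_of_hasDerivWithinAt_nonneg (convex_Ici S)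
        (f' := fun s => h s - ε) ?_ (fun s _ => ?_) fun s hs => ?_
      · exact fun s _ => ((hA s).continuousAt.sub (by fun_prop)).continuousWithinAt
      · have := (hA s).sub ((hasDerivAt_id s).const_mul ε)
        simp only [mul_one] at this
        exact this.hasDerivWithinAt
      · rw [interior_Ici] at hs
        have := hge s (le_of_lt hs)
        linarith
    have := hmono (self_mem_Ici) hs hs
    simp only at this
    linarith
  set s₁ := max S (S + (1 - A S) / ε) with hs₁
  have hpos : ∀ s ≥ s₁, 1 ≤ A s := fun s hs => by
    have h1 := hlin s ((le_max_left _ _).trans hs)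
    have h2 : (1 - A S) / ε ≤ s - S := by
      have := (le_max_right S (S + (1 - A S) / ε)).trans hs
      linarith
    rw [div_le_iff₀ hε] at h2
    linarith
  -- The Riccati inequality reads `(1/A)' ≤ -1/C`, which would make `1/A` nonpositive in finite
  -- time.
  have hanti : AntitoneOn (fun s => (A s)⁻¹ + s / C) (Ici s₁) := by
    refine antitoneOn_of_hasDerivWithinAt_nonpos (convex_Ici s₁)
      (f' := fun s => -h s / A s ^ 2 + 1 / C) (fun s hs => ?_) (fun s hs => ?_) fun s hs => ?_
    · have hne : A s ≠ 0 := by have := hpos s hs; positivity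
      exact (((hA s).continuousAt.inv₀ hne).add (by fun_prop)).continuousWithinAt
    · rw [interior_Ici] at hs
      have hne : A s ≠ 0 := by have := hpos s (le_of_lt hs); positivity
      exact (((hA s).inv hne).add ((hasDerivAt_id s).div_const C)).hasDerivWithinAt
    · rw [interior_Ici] at hs
      have h1 := hpos s (le_of_lt hs)
      have h2 := hsq s ((le_max_left _ _).trans (le_of_lt hs))
      have h3 : 1 / C ≤ h s / A s ^ 2 := by
        rw [div_le_div_iff₀ hC (by positivity)]
        linarith
      rw [neg_div]
      linarith
  set B := (A s₁)⁻¹ + s₁ / C with hB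
  have h1 : s₁ ≤ max s₁ (C * B) := le_max_left _ _
  have h2 := hanti self_mem_Ici h1 h1
  simp only at h2
  have h3 : 0 < (A (max s₁ (C * B)))⁻¹ := by have := hpos _ h1; positivity
  have h4 : B ≤ max s₁ (C * B) / C := by
    rw [le_div_iff₀ hC, mul_comm]; exact le_max_right _ _
  linarith

namespace IsSolution

variable {f G : ℝ → ℝ} {V : ℂ → ℝ}

lemma hasDerivAt_potential (hV : IsSolution f V)
    (hG : ∀ t ∈ Icc (-1 : ℝ) 1, HasDerivWithinAt G (-f t) (Icc (-1) 1) t) (x : ℝ) :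
    HasDerivAt (fun x : ℝ => G (V ⟨x, 0⟩)) (-f (V ⟨x, 0⟩) * dx V ⟨x, 0⟩) x := by
  have h1 := (hV.hasDerivAt_horizontal x le_rfl).hasDerivWithinAt (s := univ)
  have h2 := (hG _ (hV.mem_Icc ⟨x, 0⟩ le_rfl)).comp x h1 fun t _ => hV.mem_Icc _ le_rfl
  exact hasDerivWithinAt_univ.1 h2

/-- If the boundary values of a solution tend at both ends to the same zero `e` of the double-well
potential `G`, then `G` vanishes along the boundary values. -/
theorem potential_eq_zero (hV : IsSolution f V)
    (hG : ∀ t ∈ Icc (-1 : ℝ) 1, HasDerivWithinAt G (-f t) (Icc (-1) 1) t)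
    (hG0 : ∀ t ∈ Icc (-1 : ℝ) 1, 0 ≤ G t) {e r : ℝ} (hr : 0 < r) (he : e ∈ Icc (-1 : ℝ) 1)
    (hconv : ∀ t ∈ Icc (-1 : ℝ) 1, |t - e| < r → G t ≤ -(f t * (t - e)))
    (hbot : Tendsto (fun x : ℝ => V ⟨x, 0⟩) atBot (𝓝 e))
    (htop : Tendsto (fun x : ℝ => V ⟨x, 0⟩) atTop (𝓝 e)) {x : ℝ} (hx : x ≠ 0) :
    G (V ⟨x, 0⟩) = 0 := by
  set v : ℝ → ℝ := fun x => V ⟨x, 0⟩ with hv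
  have hvI : ∀ x, v x ∈ Icc (-1 : ℝ) 1 := fun x => hV.mem_Icc _ le_rfl
  set E : ℝ → ℝ := fun s => ∫ y in (0 : ℝ)..Real.pi,
    Complex.normSq (stripGrad V (s + y * Complex.I)) with hE
  set A : ℝ → ℝ := fun s => ∫ y in (0 : ℝ)..Real.pi,
    (V (Complex.exp (s + y * Complex.I)) - e) * (stripGrad V (s + y * Complex.I)).re with hA
  set H : ℝ → ℝ := fun s => ∫ y in (0 : ℝ)..Real.pi,
    (stripGrad V (s + y * Complex.I) ^ 2).re with hH
  set g : ℝ → ℝ := fun s => Real.exp s * (f (v (Real.exp s)) * (v (Real.exp s) - e) +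
        f (v (-Real.exp s)) * (v (-Real.exp s) - e)) with hg
  set γ : ℝ → ℝ := fun s => G (v (Real.exp s)) + G (v (-Real.exp s)) with hγ
  have hEc : Continuous E := continuous_integral_vertical hV.continuousOn_normSq_stripGrad
  have hvc : Continuous v := hV.continuous_boundary
  have hfc : Continuous fun x => f (v x) := hV.continuous_reaction
  have hdc : Continuous fun x : ℝ => dx V ⟨x, 0⟩ :=
    hV.continuousOn_dx.comp_continuous (continuous_mk_left 0) fun _ => by simp
  have hGc : Continuous fun x => G (v x) :=
    continuous_iff_continuousAt.2 fun x => (hV.hasDerivAt_potential hG x).continuousAt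
  have hgc : Continuous g := by
    have h1 : Continuous fun x => f (v x) * (v x - e) := hfc.mul (hvc.sub continuous_const)
    exact Real.continuous_exp.mul ((h1.comp Real.continuous_exp).add
      (h1.comp Real.continuous_exp.neg))
  have hγc : Continuous γ := (hGc.comp Real.continuous_exp).add (hGc.comp Real.continuous_exp.neg)
  have hγ0 : ∀ s, 0 ≤ γ s := fun s => add_nonneg (hG0 _ (hvI _)) (hG0 _ (hvI _))
  have hE0 : ∀ s, 0 ≤ E s := fun s =>
    intervalIntegral.integral_nonneg Real.pi_pos.le fun y _ => Complex.normSq_nonneg _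
  have hAd : ∀ s, HasDerivAt A (E s - g s) s := by
    intro s
    have h1 : ∀ s, A s = A 0 + ∫ t in (0 : ℝ)..s, (E t - g t) := fun s => by
      have := hV.energy_identity e 0 s
      simp only [Complex.ofReal_zero] at this
      simp only [hA, hE, hg, Complex.ofReal_zero]
      linarith
    have hc : Continuous fun t => E t - g t := hEc.sub hgc
    have h2 := (hc.integral_hasStrictDerivAt 0 s).hasDerivAt.const_add (A 0)
    exact h2.congr_of_eventuallyEq (Eventually.of_forall h1)
  -- Cauchy–Schwarz on an interval of length `π`, together with `|V - e| ≤ 2`.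
  have hAE : ∀ s, A s ^ 2 ≤ 4 * Real.pi * E s := by
    intro s
    have hc : ContinuousOn (fun w : ℂ => (V (Complex.exp w) - e) * (stripGrad V w).re)
        {w : ℂ | w.im ∈ Icc 0 Real.pi} :=
      (hV.continuousOn_comp_exp.sub continuousOn_const).mul
        (Complex.continuous_re.comp_continuousOn hV.continuousOn_stripGrad)
    have h1 := sq_integral_le Real.pi_pos (continuousOn_vertical hc s)
    have h2 : (∫ y in (0 : ℝ)..Real.pi, ((V (Complex.exp (s + y * Complex.I)) - e) *
        (stripGrad V (s + y * Complex.I)).re) ^ 2) ≤ ∫ y in (0 : ℝ)..Real.pi,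
          4 * Complex.normSq (stripGrad V (s + y * Complex.I)) := by
      refine intervalIntegral.integral_mono_on Real.pi_pos.le
        ((continuousOn_vertical hc s).pow 2).intervalIntegrable
        (continuousOn_const.mul
          (continuousOn_vertical hV.continuousOn_normSq_stripGrad s)).intervalIntegrable
        fun y hy => ?_
      have hVI := hV.mem_Icc (Complex.exp (s + y * Complex.I)) (exp_im_nonneg (by simpa using hy))
      rw [mul_pow, Complex.normSq_apply]
      have h4 : (V (Complex.exp (s + y * Complex.I)) - e) ^ 2 ≤ 4 := by
        nlinarith [hVI.1, hVI.2, he.1, he.2]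
      have h5 := mul_le_mul_of_nonneg_right h4 (sq_nonneg (stripGrad V (s + y * Complex.I)).re)
      nlinarith [mul_self_nonneg (stripGrad V (s + y * Complex.I)).im]
    rw [intervalIntegral.integral_const_mul] at h2
    have h3 := mul_le_mul_of_nonneg_left h2 Real.pi_pos.le
    simp only [sub_zero] at h1
    calc A s ^ 2 ≤ _ := h1
      _ ≤ _ := h3
      _ = 4 * Real.pi * E s := by simp only [hE]; ring
  -- the far-field inequality
  obtain ⟨S₀, hS₀⟩ : ∃ S₀ : ℝ, ∀ s ≥ S₀, Real.exp s * γ s ≤ -g s := by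
    have h1 : ∀ᶠ x in atTop, |v x - e| < r := by
      have := htop.eventually (Metric.ball_mem_nhds e hr)
      simpa [Real.dist_eq] using this
    have h2 : ∀ᶠ x in atBot, |v x - e| < r := by
      have := hbot.eventually (Metric.ball_mem_nhds e hr)
      simpa [Real.dist_eq] using this
    have h3 := Real.tendsto_exp_atTop.eventually h1
    have h4 := (tendsto_neg_atTop_atBot.comp Real.tendsto_exp_atTop).eventually h2
    obtain ⟨S₀, hS₀⟩ := eventually_atTop.1 (h3.and h4)
    refine ⟨S₀, fun s hs => ?_⟩
    have e1 := hconv _ (hvI _) (hS₀ s hs).1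
    have e2 := hconv _ (hvI _) (hS₀ s hs).2
    simp only [hg, hγ]
    rw [← mul_neg]
    refine mul_le_mul_of_nonneg_left ?_ (Real.exp_pos s).le
    simp only [Function.comp] at e2
    linarith
  -- Far out `A' = E - g ≥ E + e^s γ` with both terms nonnegative, so smallness of `A'` at one point
  -- makes both small there.
  have hsmall : ∀ ε > 0, ∀ S, ∃ s ≥ S, E s < ε ∧ Real.exp s * γ s < ε := by
    intro ε hε S
    obtain ⟨s, hs, hlt⟩ := exists_deriv_lt_of_sq_le (A := A) (h := fun s => E s - g s)
      (C := 4 * Real.pi) (S := max S S₀) (by positivity) hε hAd fun s hs => by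
        have h1 := hS₀ s ((le_max_right _ _).trans hs)
        have h2 : 0 ≤ Real.exp s * γ s := mul_nonneg (Real.exp_pos s).le (hγ0 s)
        exact (hAE s).trans (mul_le_mul_of_nonneg_left (by linarith) (by positivity))
    have h1 := hS₀ s ((le_max_right _ _).trans hs)
    have h2 : 0 ≤ Real.exp s * γ s := mul_nonneg (Real.exp_pos s).le (hγ0 s)
    have h3 := hE0 s
    exact ⟨s, (le_max_left _ _).trans hs, by linarith, by linarith⟩
  -- Pohozaev
  have hHE : ∀ s, |H s| ≤ E s := by
    intro s
    have := intervalIntegral.norm_integral_le_of_norm_le (μ := MeasureTheory.volume)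
      (f := fun y : ℝ => (stripGrad V (s + y * Complex.I) ^ 2).re)
      (g := fun y : ℝ => Complex.normSq (stripGrad V (s + y * Complex.I))) Real.pi_pos.le
      (Eventually.of_forall fun y _ => by
        rw [Real.norm_eq_abs]
        refine (Complex.abs_re_le_norm _).trans ?_
        rw [norm_pow, Complex.normSq_eq_norm_sq])
      (continuousOn_vertical hV.continuousOn_normSq_stripGrad s).intervalIntegrable
    exact this
  have hγd : ∀ s, HasDerivAt γ (-f (v (Real.exp s)) * dx V ⟨Real.exp s, 0⟩ * Real.exp s +
      -f (v (-Real.exp s)) * dx V ⟨-Real.exp s, 0⟩ * -Real.exp s) s := fun s => by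
    have h1 := (hV.hasDerivAt_potential hG (Real.exp s)).comp s (Real.hasDerivAt_exp s)
    have h2 := (hV.hasDerivAt_potential hG (-Real.exp s)).comp s (Real.hasDerivAt_exp s).neg
    exact h1.add h2
  -- Integrating `(e^s γ)' = e^s γ + e^s γ'` replaces the Pohozaev boundary term by the integral of
  -- the potential.
  have hpoh : ∀ s₁ s₂, 2 * ∫ s in s₁..s₂, Real.exp s * γ s =
      2 * (Real.exp s₂ * γ s₂ - Real.exp s₁ * γ s₁) - (H s₂ - H s₁) := by
    intro s₁ s₂
    set γ' : ℝ → ℝ := fun s => -f (v (Real.exp s)) * dx V ⟨Real.exp s, 0⟩ * Real.exp s +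
      -f (v (-Real.exp s)) * dx V ⟨-Real.exp s, 0⟩ * -Real.exp s with hγ'
    have hfd : Continuous fun x : ℝ => -f (v x) * dx V ⟨x, 0⟩ := hfc.neg.mul hdc
    have hγ'c : Continuous γ' :=
      ((hfd.comp Real.continuous_exp).mul Real.continuous_exp).add
        ((hfd.comp Real.continuous_exp.neg).mul Real.continuous_exp.neg)
    have i1 : Continuous fun s => Real.exp s * γ s := Real.continuous_exp.mul hγc
    have i2 : Continuous fun s => Real.exp s * γ' s := Real.continuous_exp.mul hγ'c
    have h1 : ∫ s in s₁..s₂, (Real.exp s * γ s + Real.exp s * γ' s) =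
        Real.exp s₂ * γ s₂ - Real.exp s₁ * γ s₁ :=
      intervalIntegral.integral_eq_sub_of_hasDerivAt
        (f := fun s => Real.exp s * γ s) (fun s _ => (Real.hasDerivAt_exp s).mul (hγd s))
        ((i1.add i2).intervalIntegrable _ _)
    rw [intervalIntegral.integral_add (i1.intervalIntegrable _ _) (i2.intervalIntegrable _ _)] at h1
    have h2 : H s₂ - H s₁ = 2 * ∫ s in s₁..s₂, Real.exp s * γ' s := by
      rw [← intervalIntegral.integral_const_mul]
      refine (hV.pohozaev_identity s₁ s₂).trans (intervalIntegral.integral_congr fun s _ => ?_)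
      simp only [hγ', hv]
      ring
    linarith
  -- the energy density vanishes at the origin
  obtain ⟨M, hM⟩ : ∃ M : ℝ, ∀ s ≤ 0, E s ≤ M * Real.exp s := by
    have hK : IsCompact (Metric.closedBall (0 : ℂ) 1 ∩ {z : ℂ | 0 ≤ z.im}) :=
      (isCompact_closedBall 0 1).inter_right isClosed_upper
    obtain ⟨B, hB⟩ := hK.exists_bound_of_continuousOn
      (hV.continuousOn_cgrad.mono inter_subset_right)
    refine ⟨Real.pi * B ^ 2, fun s hs => ?_⟩
    have h1 : E s ≤ ∫ _ in (0 : ℝ)..Real.pi, Real.exp s * B ^ 2 := by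
      refine intervalIntegral.integral_mono_on Real.pi_pos.le
        (continuousOn_vertical hV.continuousOn_normSq_stripGrad s).intervalIntegrable
        intervalIntegrable_const fun y hy => ?_
      have hn : ‖Complex.exp (s + y * Complex.I)‖ = Real.exp s := by
        rw [Complex.norm_exp]; simp
      have hle : Real.exp s ≤ 1 := Real.exp_le_one_iff.2 hs
      have hb := hB (Complex.exp (s + y * Complex.I))
        ⟨by rw [mem_closedBall_zero_iff, hn]; exact hle, exp_im_nonneg (by simpa using hy)⟩
      rw [Complex.normSq_eq_norm_sq, stripGrad, norm_mul, hn, mul_pow]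
      have h3 : ‖cgrad V (Complex.exp (s + y * Complex.I))‖ ^ 2 ≤ B ^ 2 :=
        pow_le_pow_left₀ (norm_nonneg _) hb 2
      have h4 : Real.exp s ^ 2 ≤ Real.exp s := by
        have := Real.exp_pos s
        nlinarith
      exact mul_le_mul h4 h3 (by positivity) (Real.exp_pos s).le
    rw [intervalIntegral.integral_const, smul_eq_mul, sub_zero] at h1
    linarith
  have i1 : Continuous fun s => Real.exp s * γ s := Real.continuous_exp.mul hγc
  have hnn : ∀ s, 0 ≤ Real.exp s * γ s := fun s => mul_nonneg (Real.exp_pos s).le (hγ0 s)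
  -- Enlarge the interval: at the right end use a point where `E` and `e^s γ` are small, at the left
  -- end let `s₁ → -∞`, where the term `-e^s₁ γ` already has the good sign.
  have hzero : ∀ a b, a ≤ b → ∫ s in a..b, Real.exp s * γ s = 0 := by
    intro a b hab
    refine le_antisymm (le_of_forall_pos_le_add fun ε hε => ?_)
      (intervalIntegral.integral_nonneg hab fun s _ => hnn s)
    rw [zero_add]
    obtain ⟨s₂, hs₂, hE₂, hγ₂⟩ := hsmall (ε / 2) (by positivity) b
    obtain ⟨s₁, hs₁a, hs₁0, hs₁⟩ : ∃ s₁ ≤ a, s₁ ≤ 0 ∧ M * Real.exp s₁ < ε / 2 := by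
      have h1 : Tendsto (fun s => M * Real.exp s) atBot (𝓝 (M * 0)) :=
        Real.tendsto_exp_atBot.const_mul M
      rw [mul_zero] at h1
      obtain ⟨s₁, h⟩ := ((h1.eventually (eventually_lt_nhds (by positivity : (0 : ℝ) < ε / 2))).and
        ((eventually_le_atBot a).and (eventually_le_atBot 0))).exists
      exact ⟨s₁, h.2.1, h.2.2, h.1⟩
    have h1 := hpoh s₁ s₂
    have h2 := (abs_le.1 (hHE s₂)).1
    have h3 := (abs_le.1 (hHE s₁)).2
    have h4 := hM s₁ hs₁0
    have h5 := hnn s₁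
    have h6 : ∫ s in a..b, Real.exp s * γ s ≤ ∫ s in s₁..s₂, Real.exp s * γ s :=
      intervalIntegral.integral_mono_interval hs₁a hab hs₂ (Eventually.of_forall hnn)
        (i1.intervalIntegrable _ _)
    linarith
  have hγzero : ∀ s, γ s = 0 := by
    intro s
    have h1 := (i1.integral_hasStrictDerivAt (s - 1) s).hasDerivAt
    have h2 : (fun u => ∫ t in (s - 1)..u, Real.exp t * γ t) =ᶠ[𝓝 s] fun _ => 0 := by
      filter_upwards [Ioi_mem_nhds (sub_one_lt s)] with u hu using hzero _ _ (le_of_lt hu)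
    have h3 := h1.unique ((hasDerivAt_const s (0 : ℝ)).congr_of_eventuallyEq h2)
    exact (mul_eq_zero.1 h3).resolve_left (Real.exp_ne_zero s)
  have h1 := hγzero (Real.log |x|)
  simp only [hγ] at h1
  rw [Real.exp_log (abs_pos.2 hx)] at h1
  have h2 := hG0 _ (hvI |x|)
  have h3 := hG0 _ (hvI (-|x|))
  rcases abs_choice x with h | h
  · rw [h] at h1 h2 h3
    exact le_antisymm (by linarith) h2
  · rw [h, neg_neg] at h1 h3
    rw [h] at h2
    exact le_antisymm (by linarith) h3

end IsSolution

/-! ### Sliding -/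

/-- Used with `c = 0` at a boundary minimum, and with `c > 0` from the Hopf lemma. -/
lemma le_deriv_of_mul_le {g : ℝ → ℝ} {g' c : ℝ} (hg : HasDerivWithinAt g g' (Ici 0) 0)
    (hle : ∀ y ∈ Icc (0 : ℝ) 1, g 0 + c * y ≤ g y) : c ≤ g' := by
  have h1 := (hasDerivWithinAt_iff_tendsto_slope' (notMem_Ioi.2 (le_refl (0 : ℝ)))).1
    hg.Ioi_of_Ici
  refine ge_of_tendsto h1 ?_
  filter_upwards [Ioc_mem_nhdsGT (zero_lt_one' ℝ)] with y hy
  rw [slope_def_field, sub_zero, le_div_iff₀ hy.1]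
  have := hle y ⟨hy.1.le, hy.2⟩
  linarith

lemma eq_zero_of_upper {u : ℂ → ℝ} (hu : ContinuousOn u {z : ℂ | 0 ≤ z.im})
    (h0 : ∀ z : ℂ, 0 < z.im → u z = 0) {z : ℂ} (hz : 0 ≤ z.im) : u z = 0 := by
  have hc : ContinuousWithinAt (fun y : ℝ => u ⟨z.re, y⟩) (Ioi z.im) z.im :=
    (hu z hz).comp (t := {z : ℂ | 0 ≤ z.im}) (continuous_mk_right z.re).continuousWithinAt
      fun y hy => hz.trans (le_of_lt hy)
  refine tendsto_nhds_unique hc (tendsto_const_nhds.congr' ?_)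
  filter_upwards [self_mem_nhdsWithin] with y hy
  exact (h0 ⟨z.re, y⟩ (hz.trans_lt hy)).symm

lemma add_ofReal_mk (x y t : ℝ) : (⟨x, y⟩ + t : ℂ) = ⟨x + t, y⟩ := by
  apply Complex.ext <;> simp

/-- Solutions connecting `-1` to `1`. -/
structure IsConnection (f : ℝ → ℝ) (V : ℂ → ℝ) : Prop where
  isSolution : IsSolution f V
  tendsto_atBot : Tendsto (fun x : ℝ => V ⟨x, 0⟩) atBot (𝓝 (-1))
  tendsto_atTop : Tendsto (fun x : ℝ => V ⟨x, 0⟩) atTop (𝓝 1)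

namespace IsSolution

variable {f : ℝ → ℝ} {U V : ℂ → ℝ}

lemma harmonic_sub (hU : IsSolution f U) (hV : IsSolution f V) :
    HarmonicOnNhd (fun z => U z - V z) {z : ℂ | 0 < z.im} := fun z hz =>
  (hU.harmonic z hz).sub (hV.harmonic z hz)

lemma le_of_boundary_le (hU : IsSolution f U) (hV : IsSolution f V) {m : ℝ}
    (h : ∀ x : ℝ, m ≤ U ⟨x, 0⟩ - V ⟨x, 0⟩) {z : ℂ} (hz : 0 ≤ z.im) : m ≤ U z - V z :=
  ge_of_boundary_ge (hU.harmonic_sub hV) (hU.continuousOn.sub hV.continuousOn) (C := -2)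
    (fun z hz => by linarith [(hU.mem_Icc z hz).1, (hV.mem_Icc z hz).2]) h z hz

/-- Comparison of two solutions with the same limits at infinity. -/
theorem boundary_le_of_reaction_lt (hU : IsSolution f U) (hV : IsSolution f V)
    (hbot : Tendsto (fun x : ℝ => U ⟨x, 0⟩ - V ⟨x, 0⟩) atBot (𝓝 0))
    (htop : Tendsto (fun x : ℝ => U ⟨x, 0⟩ - V ⟨x, 0⟩) atTop (𝓝 0))
    (hlt : ∀ x : ℝ, U ⟨x, 0⟩ < V ⟨x, 0⟩ → f (V ⟨x, 0⟩) < f (U ⟨x, 0⟩)) (x : ℝ) :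
    V ⟨x, 0⟩ ≤ U ⟨x, 0⟩ := by
  by_contra! hx
  have hc : Continuous fun x : ℝ => U ⟨x, 0⟩ - V ⟨x, 0⟩ :=
    hU.continuous_boundary.sub hV.continuous_boundary
  -- A negative value forces a negative boundary minimum, since the difference tends to `0` at both
  -- ends. By Phragmén–Lindelöf it is also the minimum over the half-plane, so the vertical
  -- derivative there is nonnegative, against `hlt`.
  obtain ⟨x₁, hx₁⟩ := hc.exists_forall_le' x (by
    rw [cocompact_eq_atBot_atTop, eventually_sup]
    have h0 : U ⟨x, 0⟩ - V ⟨x, 0⟩ < 0 := sub_neg.2 hx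
    exact ⟨(hbot.eventually (eventually_gt_nhds h0)).mono fun _ h => h.le,
      (htop.eventually (eventually_gt_nhds h0)).mono fun _ h => h.le⟩)
  have hmin : 0 ≤ -f (U ⟨x₁, 0⟩) - -f (V ⟨x₁, 0⟩) := by
    refine le_deriv_of_mul_le ((hU.boundary x₁).sub (hV.boundary x₁)) fun y hy => ?_
    rw [zero_mul, add_zero]
    exact hU.le_of_boundary_le hV hx₁ (z := ⟨x₁, y⟩) hy.1
  have h2 := hx₁ x
  have := hlt x₁ (by linarith)
  linarith

/-- Two ordered solutions whose boundary values touch coincide. -/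
theorem eq_of_le_of_boundary_eq (hU : IsSolution f U) (hV : IsSolution f V)
    (hle : ∀ x : ℝ, V ⟨x, 0⟩ ≤ U ⟨x, 0⟩) {x₀ : ℝ} (h0 : V ⟨x₀, 0⟩ = U ⟨x₀, 0⟩) :
    ∀ z : ℂ, 0 ≤ z.im → V z = U z := by
  have hnn : ∀ z : ℂ, 0 ≤ z.im → 0 ≤ U z - V z := fun z hz =>
    hU.le_of_boundary_le hV (fun x => sub_nonneg.2 (hle x)) hz
  have hc : ContinuousOn (fun z => U z - V z) {z : ℂ | 0 ≤ z.im} :=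
    hU.continuousOn.sub hV.continuousOn
  by_cases hpos : ∀ z : ℂ, 0 < z.im → 0 < U z - V z
  -- At a contact point the equation gives both functions the same vertical derivative, which Hopf
  -- forbids.
  · obtain ⟨c, hcpos, hc'⟩ := exists_linear_lower_bound (hU.harmonic_sub hV) hc hnn hpos x₀
    have h1 : c ≤ -f (U ⟨x₀, 0⟩) - -f (V ⟨x₀, 0⟩) := by
      refine le_deriv_of_mul_le ((hU.boundary x₀).sub (hV.boundary x₀)) fun y hy => ?_
      have := hc' y hy
      simp only [Pi.sub_apply]
      linarith
    rw [h0] at h1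
    linarith
  · push Not at hpos
    obtain ⟨z₀, hz₀, hz₀'⟩ := hpos
    have hzero := eq_zero_of_nonneg (hU.harmonic_sub hV) (fun z hz => hnn z hz.le) hz₀
      (le_antisymm hz₀' (hnn z₀ hz₀.le))
    intro z hz
    exact (sub_eq_zero.1 (eq_zero_of_upper hc hzero hz)).symm

end IsSolution

/-! ### Connections: uniqueness up to translation and strict monotonicity -/

namespace IsConnection

variable {f : ℝ → ℝ} {V V₁ V₂ : ℂ → ℝ}

lemma tendsto_translate_sub (h₁ : IsConnection f V₁) (h₂ : IsConnection f V₂) (t : ℝ) :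
    Tendsto (fun x : ℝ => V₂ (⟨x, 0⟩ + t) - V₁ ⟨x, 0⟩) atBot (𝓝 0) ∧
      Tendsto (fun x : ℝ => V₂ (⟨x, 0⟩ + t) - V₁ ⟨x, 0⟩) atTop (𝓝 0) := by
  simp only [add_ofReal_mk]
  constructor
  · simpa using (h₂.tendsto_atBot.comp (tendsto_atBot_add_const_right _ t tendsto_id)).sub
      h₁.tendsto_atBot
  · simpa using (h₂.tendsto_atTop.comp (tendsto_atTop_add_const_right _ t tendsto_id)).sub
      h₁.tendsto_atTop

/-- The sliding method: two connections differ by a translation `b`, and all larger translations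
are ordered. -/
theorem exists_translate (h₁ : IsConnection f V₁) (h₂ : IsConnection f V₂) {r : ℝ} (hr : 0 < r)
    (hleft : StrictAntiOn f (Icc (-1) (-1 + r))) (hright : StrictAntiOn f (Icc (1 - r) 1)) :
    ∃ b : ℝ, (∀ z : ℂ, 0 ≤ z.im → V₁ z = V₂ (z + b)) ∧
      ∀ t ≥ b, ∀ x : ℝ, V₁ ⟨x, 0⟩ ≤ V₂ ⟨x + t, 0⟩ := by
  set v₁ : ℝ → ℝ := fun x => V₁ ⟨x, 0⟩ with hv₁
  set v₂ : ℝ → ℝ := fun x => V₂ ⟨x, 0⟩ with hv₂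
  have hI₁ : ∀ x, v₁ x ∈ Icc (-1 : ℝ) 1 := fun x => h₁.isSolution.mem_Icc _ le_rfl
  have hI₂ : ∀ x, v₂ x ∈ Icc (-1 : ℝ) 1 := fun x => h₂.isSolution.mem_Icc _ le_rfl
  have hc₁ : Continuous v₁ := h₁.isSolution.continuous_boundary
  have hc₂ : Continuous v₂ := h₂.isSolution.continuous_boundary
  obtain ⟨R, hR⟩ : ∃ R : ℝ, ∀ x ≥ R, 1 - r ≤ v₁ x ∧ 1 - r ≤ v₂ x :=
    eventually_atTop.1 <| ((h₁.tendsto_atTop.eventually (eventually_gt_nhds (by linarith))).and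
      (h₂.tendsto_atTop.eventually (eventually_gt_nhds (by linarith)))).mono
        fun x hx => ⟨hx.1.le, hx.2.le⟩
  obtain ⟨L, hL⟩ : ∃ L : ℝ, ∀ x ≤ L, v₁ x ≤ -1 + r ∧ v₂ x ≤ -1 + r :=
    eventually_atBot.1 <| ((h₁.tendsto_atBot.eventually (eventually_lt_nhds (by linarith))).and
      (h₂.tendsto_atBot.eventually (eventually_lt_nhds (by linarith)))).mono
        fun x hx => ⟨hx.1.le, hx.2.le⟩
  -- comparison for translates that are ordered wherever the two profiles are not both close to
  -- the same end state
  have hcomp : ∀ t : ℝ, (∀ x, v₂ (x + t) < v₁ x → (R ≤ x + t ∧ v₂ (x + t) < v₁ x) ∨ x ≤ L) →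
      ∀ x, v₁ x ≤ v₂ (x + t) := by
    intro t ht
    have := IsSolution.boundary_le_of_reaction_lt (h₂.isSolution.translate t) h₁.isSolution
      (h₁.tendsto_translate_sub h₂ t).1 (h₁.tendsto_translate_sub h₂ t).2 fun x hx => ?_
    · simpa only [add_ofReal_mk] using this
    · simp only [add_ofReal_mk] at hx ⊢
      rcases ht x hx with h | h
      · have e := (hR _ h.1).2
        exact hright ⟨e, (hI₂ _).2⟩ ⟨e.trans hx.le, (hI₁ x).2⟩ hx
      · have e := (hL _ h).1
        exact hleft ⟨(hI₂ _).1, hx.le.trans e⟩ ⟨(hI₁ x).1, e⟩ hx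
  -- Quantifying over all `s ≥ t` makes the set upward closed, so every shift beyond its infimum is
  -- ordered.
  set T : Set ℝ := {t | ∀ s ≥ t, ∀ x, v₁ x ≤ v₂ (x + s)} with hT
  have hTne : (R - L) ∈ T := fun s hs x => by
    refine hcomp s (fun x hx => ?_) x
    by_cases h : R ≤ x + s
    · exact Or.inl ⟨h, hx⟩
    · right
      have : R - L ≤ s := hs
      linarith
  have hTbdd : BddBelow T := by
    obtain ⟨x₁, hx₁⟩ := (h₁.tendsto_atTop.eventually (eventually_gt_nhds zero_lt_one)).exists
    obtain ⟨X, hX⟩ := eventually_atBot.1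
      (h₂.tendsto_atBot.eventually (eventually_lt_nhds (by norm_num : (-1 : ℝ) < 0)))
    refine ⟨X - x₁, fun t ht => ?_⟩
    by_contra! hlt
    have e1 := ht t le_rfl x₁
    have e2 := hX (x₁ + t) (by linarith)
    simp only [hv₁, hv₂] at e1
    linarith
  set b := sInf T with hb
  have hgt : ∀ s > b, ∀ x, v₁ x ≤ v₂ (x + s) := fun s hs => by
    obtain ⟨t, ht, hts⟩ := exists_lt_of_csInf_lt ⟨_, hTne⟩ hs
    exact ht s hts.le
  have hbT : ∀ x, v₁ x ≤ v₂ (x + b) := fun x => by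
    have h1 : Tendsto (fun s => v₂ (x + s)) (𝓝[>] b) (𝓝 (v₂ (x + b))) :=
      ((hc₂.comp (continuous_const.add continuous_id)).tendsto b).mono_left nhdsWithin_le_nhds
    exact ge_of_tendsto h1 (eventually_nhdsWithin_of_forall fun s hs => hgt s hs x)
  -- Without contact at the critical shift, strict order persists on a compact interval for slightly
  -- smaller shifts, and `hcomp` handles its complement, contradicting minimality of `b`.
  have htouch : ∃ x₀, v₁ x₀ = v₂ (x₀ + b) := by
    by_contra! hne
    have hlt : ∀ x, v₁ x < v₂ (x + b) := fun x => lt_of_le_of_ne (hbT x) (hne x)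
    -- Shifts down to `b - 1/2` are considered, and to the right of this interval they still give `x
    -- + s ≥ R`.
    set K := Icc L (R + |b| + 1) with hK
    have hev : ∀ᶠ t in 𝓝 b, ∀ x ∈ K, v₁ x < v₂ (x + t) := by
      refine isCompact_Icc.eventually_forall_of_forall_eventually fun x _ => ?_
      have c1 : Continuous fun p : ℝ × ℝ => v₁ p.2 := hc₁.comp continuous_snd
      have c2 : Continuous fun p : ℝ × ℝ => v₂ (p.2 + p.1) :=
        hc₂.comp (continuous_snd.add continuous_fst)
      exact c1.continuousAt.eventually_lt c2.continuousAt (hlt x)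
    obtain ⟨η, hη, hη'⟩ := Metric.eventually_nhds_iff.1 hev
    have hmem : b - min η 1 / 2 ∈ T := by
      intro s hs x
      by_cases hsb : b < s
      · exact hgt s hsb x
      have hmin : 0 < min η 1 := lt_min hη one_pos
      have hs' : b - min η 1 / 2 ≤ s := hs
      refine hcomp s (fun x hx => ?_) x
      have hxK : x ∉ K := fun h => by
        have := hη' (y := s) (by
          rw [Real.dist_eq, abs_lt]
          have := min_le_left η 1
          constructor <;> linarith) x h
        exact absurd hx (not_lt.2 this.le)
      rw [hK, mem_Icc, not_and_or, not_le, not_le] at hxK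
      rcases hxK with h | h
      · exact Or.inr h.le
      · refine Or.inl ⟨?_, hx⟩
        have := neg_abs_le b
        have := min_le_right η 1
        linarith
    have h1 := csInf_le hTbdd hmem
    have hmin : 0 < min η 1 := lt_min hη one_pos
    linarith
  obtain ⟨x₀, hx₀⟩ := htouch
  refine ⟨b, ?_, fun t ht x => ?_⟩
  · refine IsSolution.eq_of_le_of_boundary_eq (h₂.isSolution.translate b) h₁.isSolution
      (x₀ := x₀) (fun x => ?_) ?_
    · rw [add_ofReal_mk]; exact hbT x
    · rw [add_ofReal_mk]; exact hx₀
  · rcases (show b ≤ t from ht).eq_or_lt with h | h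
    · exact h ▸ hbT x
    · exact hgt t h x

/-- The boundary values of a connection are nondecreasing. -/
theorem monotone_boundary (h : IsConnection f V) {r : ℝ} (hr : 0 < r)
    (hleft : StrictAntiOn f (Icc (-1) (-1 + r))) (hright : StrictAntiOn f (Icc (1 - r) 1)) :
    Monotone fun x : ℝ => V ⟨x, 0⟩ := by
  obtain ⟨b, hb, hord⟩ := h.exists_translate h hr hleft hright
  -- Compared with itself, the connection is invariant under the critical shift `b`. If `b > 0`,
  -- iterating to `+∞` would give the constant `1`; so `b ≤ 0` and all nonnegative shifts are
  -- ordered.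
  have hper : ∀ (n : ℕ) (x : ℝ), V ⟨x, 0⟩ = V ⟨x + n * b, 0⟩ := by
    intro n
    induction n with
    | zero => simp
    | succ n ih =>
      intro x
      rw [ih x, hb _ le_rfl, add_ofReal_mk]
      congr 2
      push_cast; ring
  have hb0 : b ≤ 0 := by
    by_contra! hpos
    have h1 : ∀ x : ℝ, V ⟨x, 0⟩ = 1 := fun x => by
      have h2 : Tendsto (fun n : ℕ => V ⟨x + n * b, 0⟩) atTop (𝓝 1) :=
        h.tendsto_atTop.comp (tendsto_atTop_add_const_left _ x
          (tendsto_natCast_atTop_atTop.atTop_mul_const hpos))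
      simp only [← hper] at h2
      exact tendsto_nhds_unique tendsto_const_nhds h2
    have h2 := h.tendsto_atBot
    simp only [h1] at h2
    have := tendsto_nhds_unique tendsto_const_nhds h2
    norm_num at this
  intro x x' hxx
  have := hord (x' - x) (by linarith) x
  simpa using this

/-- A connection is a layer. -/
theorem isLayer (h : IsConnection f V) {r : ℝ} (hr : 0 < r)
    (hleft : StrictAntiOn f (Icc (-1) (-1 + r))) (hright : StrictAntiOn f (Icc (1 - r) 1))
    (hf : DifferentiableOn ℝ f (Icc (-1) 1)) : IsLayer f V := by
  have hV := h.isSolution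
  have hmono := h.monotone_boundary hr hleft hright
  have hmonoV : ∀ y : ℝ, 0 ≤ y → Monotone fun x : ℝ => V ⟨x, y⟩ := fun y hy x x' hxx => by
    have := (hV.translate (x' - x)).le_of_boundary_le hV (m := 0) (fun s => by
      rw [add_ofReal_mk, sub_nonneg]
      exact hmono (by linarith)) (z := ⟨x, y⟩) hy
    rw [add_ofReal_mk, add_sub_cancel] at this
    exact sub_nonneg.1 this
  have hnn : ∀ z : ℂ, 0 ≤ z.im → 0 ≤ dx V z := fun z hz => by
    have h1 := (hV.hasDerivAt_horizontal z.re hz).deriv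
    rw [← h1]
    exact (hmonoV z.im hz).deriv_nonneg
  have hposint : ∀ z : ℂ, 0 < z.im → 0 < dx V z := by
    by_contra! hcon
    obtain ⟨z₀, hz₀, hle⟩ := hcon
    have hzero := eq_zero_of_nonneg hV.harmonic_dx (fun z hz => hnn z hz.le) hz₀
      (le_antisymm hle (hnn z₀ hz₀.le))
    have hbd : ∀ x : ℝ, dx V ⟨x, 0⟩ = 0 := fun x =>
      eq_zero_of_upper hV.continuousOn_dx hzero le_rfl
    have hconst : ∀ x : ℝ, V ⟨x, 0⟩ = V ⟨0, 0⟩ := fun x =>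
      is_const_of_deriv_eq_zero (f := fun x : ℝ => V ⟨x, 0⟩)
        (fun x => (hV.hasDerivAt_horizontal x le_rfl).differentiableAt)
        (fun x => by rw [(hV.hasDerivAt_horizontal x le_rfl).deriv, hbd]) x 0
    have h1 := h.tendsto_atBot
    have h2 := h.tendsto_atTop
    simp only [fun x => hconst x] at h1 h2
    have e1 := tendsto_nhds_unique tendsto_const_nhds h1
    have e2 := tendsto_nhds_unique tendsto_const_nhds h2
    linarith
  have hposbd : ∀ x₀ : ℝ, 0 < dx V ⟨x₀, 0⟩ := by
    intro x₀
    refine lt_of_le_of_ne (hnn _ le_rfl) fun h0 => ?_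
    obtain ⟨c, hc, hlow⟩ :=
      exists_linear_lower_bound hV.harmonic_dx hV.continuousOn_dx hnn hposint x₀
    -- The trace of `V_y` is `-f(V)`, with tangential derivative `-f'(V) V_x`, which vanishes at
    -- `x₀`.
    have hd : HasDerivAt (fun x : ℝ => dy V ⟨x, 0⟩) 0 x₀ := by
      have h1 := (hf _ (hV.mem_Icc ⟨x₀, 0⟩ le_rfl)).hasDerivWithinAt
      have h2 := h1.comp x₀ (hV.hasDerivAt_horizontal x₀ le_rfl).hasDerivWithinAt (s := univ)
        fun t _ => hV.mem_Icc _ le_rfl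
      rw [← h0, mul_zero] at h2
      have h3 := (hasDerivWithinAt_univ.1 h2).neg
      simp only [neg_zero] at h3
      exact h3.congr_of_eventuallyEq (Eventually.of_forall fun x => hV.dy_boundary x)
    obtain ⟨δ, hδ, hup⟩ := exists_tangential_deriv_le hV.harmonic_dy hV.continuousOn_dy hd
      (half_pos hc)
    set y₁ := min δ 1 / 2 with hy₁
    have hmin : 0 < min δ 1 := lt_min hδ one_pos
    have hy₁pos : 0 < y₁ := half_pos hmin
    have hy₁δ : y₁ < δ := by have := min_le_left δ 1; linarith
    have hy₁1 : y₁ ≤ 1 := by have := min_le_right δ 1; linarith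
    -- The mean value theorem bounds `V_x` at height `y₁` by `(c/2) y₁`, whereas Hopf gives at least
    -- `c y₁`.
    obtain ⟨ξ, hξ, hξ'⟩ := exists_hasDerivAt_eq_slope (fun t : ℝ => dx V ⟨x₀, t⟩)
      (fun t => fderiv ℝ (dy V) ⟨x₀, t⟩ 1) hy₁pos
      (hV.continuousOn_dx.comp (continuous_mk_right x₀).continuousOn fun t ht => ht.1)
      fun t ht => hV.hasDerivAt_dx_vertical x₀ ht.1
    have e1 := hup ξ ⟨hξ.1, hξ.2.trans hy₁δ⟩
    rw [hξ', ← h0, sub_zero, sub_zero, div_le_iff₀ hy₁pos] at e1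
    have e2 := hlow y₁ ⟨hy₁pos.le, hy₁1⟩
    nlinarith
  have hpos : ∀ x y : ℝ, 0 ≤ y → 0 < deriv (fun t : ℝ => V ⟨t, y⟩) x := fun x y hy => by
    rw [(hV.hasDerivAt_horizontal x hy).deriv]
    rcases hy.eq_or_lt with h0 | h0
    · exact h0 ▸ hposbd x
    · exact hposint ⟨x, y⟩ h0
  refine ⟨hV, fun z hz => ?_, hpos, h.tendsto_atBot, h.tendsto_atTop⟩
  have hstrict : StrictMono fun t : ℝ => V ⟨t, z.im⟩ :=
    strictMono_of_deriv_pos fun x => hpos x z.im hz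
  have h1 : V ⟨z.re - 1, z.im⟩ < V z := hstrict (sub_one_lt z.re)
  have h2 : V z < V ⟨z.re + 1, z.im⟩ := hstrict (lt_add_one z.re)
  exact ⟨(hV.mem_Icc ⟨z.re - 1, z.im⟩ hz).1.trans_lt h1,
    h2.trans_le (hV.mem_Icc ⟨z.re + 1, z.im⟩ hz).2⟩

end IsConnection

/-! ### Double-well potentials -/

namespace IsDoubleWell

variable {G : ℝ → ℝ}

lemma uniqueDiffOn : UniqueDiffOn ℝ (Icc (-1 : ℝ) 1) := uniqueDiffOn_Icc (by norm_num)

lemma hasDerivWithinAt (hG : IsDoubleWell G) {t : ℝ} (ht : t ∈ Icc (-1 : ℝ) 1) :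
    HasDerivWithinAt G (derivWithin G (Icc (-1) 1) t) (Icc (-1) 1) t :=
  (hG.contDiffOn.differentiableOn two_ne_zero t ht).hasDerivWithinAt

lemma hasDerivWithinAt_reaction (hG : IsDoubleWell G) {t : ℝ} (ht : t ∈ Icc (-1 : ℝ) 1) :
    HasDerivWithinAt G (-reaction G t) (Icc (-1) 1) t := by
  simpa only [reaction, neg_neg] using hG.hasDerivWithinAt ht

lemma contDiffOn_derivWithin (hG : IsDoubleWell G) :
    ContDiffOn ℝ 1 (derivWithin G (Icc (-1) 1)) (Icc (-1) 1) :=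
  hG.contDiffOn.derivWithin uniqueDiffOn (by norm_num)

lemma differentiableOn_reaction (hG : IsDoubleWell G) :
    DifferentiableOn ℝ (reaction G) (Icc (-1) 1) :=
  (hG.contDiffOn_derivWithin.differentiableOn one_ne_zero).neg

lemma iteratedDerivWithin_two (t : ℝ) : iteratedDerivWithin 2 G (Icc (-1) 1) t =
    derivWithin (derivWithin G (Icc (-1) 1)) (Icc (-1) 1) t := by
  rw [iteratedDerivWithin_succ, iteratedDerivWithin_one]

lemma strictMonoOn_derivWithin (hG : IsDoubleWell G) {a b : ℝ} (ha : -1 ≤ a) (hb : b ≤ 1)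
    (hpos : ∀ t ∈ Ioo a b, 0 < iteratedDerivWithin 2 G (Icc (-1) 1) t) :
    StrictMonoOn (derivWithin G (Icc (-1) 1)) (Icc a b) := by
  refine strictMonoOn_of_deriv_pos (convex_Icc a b)
    (hG.contDiffOn_derivWithin.continuousOn.mono (Icc_subset_Icc ha hb)) fun t ht => ?_
  rw [interior_Icc] at ht
  have h := hpos t ht
  rw [iteratedDerivWithin_two, derivWithin_of_mem_nhds
    (Icc_mem_nhds (ha.trans_lt ht.1) (ht.2.trans_le hb))] at h
  exact h

/-- `G''` is continuous and positive at the two wells. This one fact supplies both the convexity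
inequality of part (a) and the decrease of `f` needed for sliding. -/
lemma exists_strictMonoOn (hG : IsDoubleWell G) : ∃ r > 0, r ≤ 1 ∧
    StrictMonoOn (derivWithin G (Icc (-1) 1)) (Icc (-1) (-1 + r)) ∧
    StrictMonoOn (derivWithin G (Icc (-1) 1)) (Icc (1 - r) 1) := by
  have hc : ContinuousOn (iteratedDerivWithin 2 G (Icc (-1) 1)) (Icc (-1) 1) :=
    hG.contDiffOn.continuousOn_iteratedDerivWithin le_rfl uniqueDiffOn
  have key : ∀ e ∈ Icc (-1 : ℝ) 1, 0 < iteratedDerivWithin 2 G (Icc (-1) 1) e →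
      ∃ r > 0, ∀ t ∈ Icc (-1 : ℝ) 1, |t - e| < r →
        0 < iteratedDerivWithin 2 G (Icc (-1) 1) t := fun e he h => by
    obtain ⟨r, hr, hr'⟩ := Metric.mem_nhdsWithin_iff.1 ((hc e he).eventually (eventually_gt_nhds h))
    exact ⟨r, hr, fun t ht htr => hr' ⟨by rwa [Metric.mem_ball, Real.dist_eq], ht⟩⟩
  obtain ⟨r₁, hr₁, h₁⟩ := key (-1) (by norm_num) hG.second_deriv_left
  obtain ⟨r₂, hr₂, h₂⟩ := key 1 (by norm_num) hG.second_deriv_right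
  have e1 : min (min r₁ r₂) 1 ≤ r₁ := (min_le_left _ _).trans (min_le_left _ _)
  have e2 : min (min r₁ r₂) 1 ≤ r₂ := (min_le_left _ _).trans (min_le_right _ _)
  have e3 : min (min r₁ r₂) 1 ≤ 1 := min_le_right _ _
  have e0 : 0 < min (min r₁ r₂) 1 := lt_min (lt_min hr₁ hr₂) one_pos
  refine ⟨min (min r₁ r₂) 1, e0, e3, ?_, ?_⟩
  · refine hG.strictMonoOn_derivWithin le_rfl (by linarith) fun t ht => ?_
    have := ht.1
    have := ht.2
    exact h₁ t ⟨by linarith, by linarith⟩ (by rw [abs_lt]; constructor <;> linarith)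
  · refine hG.strictMonoOn_derivWithin (by linarith) le_rfl fun t ht => ?_
    have := ht.1
    have := ht.2
    exact h₂ t ⟨by linarith, by linarith⟩ (by rw [abs_lt]; constructor <;> linarith)

/-- The potential is convex near its zeros. -/
lemma exists_potential_le (hG : IsDoubleWell G) {e : ℝ} (he : e = -1 ∨ e = 1) :
    ∃ r > 0, ∀ t ∈ Icc (-1 : ℝ) 1, |t - e| < r → G t ≤ -(reaction G t * (t - e)) := by
  obtain ⟨r, hr, hr1, hl, hrt⟩ := hG.exists_strictMonoOn
  -- With `c` between `e` and `t`, `G t = G'(c) (t - e)`, and monotonicity of `G'` replaces `c` by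
  -- `t`.
  have hmvt : ∀ a b : ℝ, -1 ≤ a → b ≤ 1 → a < b →
      ∃ c ∈ Ioo a b, derivWithin G (Icc (-1) 1) c = (G b - G a) / (b - a) :=
    fun a b ha hb hab => by
      refine exists_hasDerivAt_eq_slope G _ hab
        (hG.contDiffOn.continuousOn.mono (Icc_subset_Icc ha hb)) fun t ht => ?_
      exact (hG.hasDerivWithinAt ⟨ha.trans ht.1.le, ht.2.le.trans hb⟩).hasDerivAt
        (Icc_mem_nhds (ha.trans_lt ht.1) (ht.2.trans_le hb))
  refine ⟨r, hr, fun t ht htr => ?_⟩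
  rw [abs_lt] at htr
  simp only [reaction, neg_mul, neg_neg]
  rcases he with rfl | rfl
  · have h0 : G (-1) = 0 := (hG.eq_zero_iff _ (by norm_num)).2 (Or.inl rfl)
    rcases ht.1.eq_or_lt with h | h
    · rw [← h, h0]; norm_num
    · obtain ⟨c, hc, hc'⟩ := hmvt (-1) t le_rfl ht.2 h
      have h1 : derivWithin G (Icc (-1) 1) c < derivWithin G (Icc (-1) 1) t :=
        hl ⟨hc.1.le, by linarith [hc.2]⟩ ⟨ht.1, by linarith⟩ hc.2
      rw [hc', h0, sub_zero, div_lt_iff₀ (by linarith)] at h1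
      exact h1.le
  · have h0 : G 1 = 0 := (hG.eq_zero_iff _ (by norm_num)).2 (Or.inr rfl)
    rcases ht.2.eq_or_lt with h | h
    · rw [h, h0]; norm_num
    · obtain ⟨c, hc, hc'⟩ := hmvt t 1 ht.1 le_rfl h
      have h1 : derivWithin G (Icc (-1) 1) t < derivWithin G (Icc (-1) 1) c :=
        hrt ⟨by linarith, ht.2⟩ ⟨by linarith [hc.1], hc.2.le⟩ hc.1
      rw [hc', h0, zero_sub, lt_div_iff₀ (by linarith)] at h1
      linarith

lemma exists_strictAntiOn (hG : IsDoubleWell G) : ∃ r > 0,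
    StrictAntiOn (reaction G) (Icc (-1) (-1 + r)) ∧ StrictAntiOn (reaction G) (Icc (1 - r) 1) := by
  obtain ⟨r, hr, -, hl, hrt⟩ := hG.exists_strictMonoOn
  exact ⟨r, hr, fun s hs t ht hst => neg_lt_neg (hl hs ht hst),
    fun s hs t ht hst => neg_lt_neg (hrt hs ht hst)⟩

/-- There are no homoclinic solutions. -/
theorem eq_const_of_homoclinic (hG : IsDoubleWell G) {V : ℂ → ℝ} (hV : IsSolution (reaction G) V)
    {e : ℝ} (he : e = -1 ∨ e = 1) (hbot : Tendsto (fun x : ℝ => V ⟨x, 0⟩) atBot (𝓝 e))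
    (htop : Tendsto (fun x : ℝ => V ⟨x, 0⟩) atTop (𝓝 e)) {z : ℂ} (hz : 0 ≤ z.im) : V z = e := by
  obtain ⟨r, hr, hconv⟩ := hG.exists_potential_le he
  have heI : e ∈ Icc (-1 : ℝ) 1 := by rcases he with rfl | rfl <;> norm_num
  have hc := hV.continuous_boundary
  -- The point `x = 0` is missed by `±e^s`; density and continuity recover it.
  have hsq : ∀ x : ℝ, V ⟨x, 0⟩ ^ 2 = 1 := by
    refine congrFun ((hc.pow 2).ext_on (dense_compl_singleton (0 : ℝ)) continuous_const ?_)
    intro x hx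
    have h0 := hV.potential_eq_zero (fun t ht => hG.hasDerivWithinAt_reaction ht) hG.nonneg hr heI
      hconv hbot htop hx
    rcases (hG.eq_zero_iff _ (hV.mem_Icc _ le_rfl)).1 h0 with h | h <;> simp [h]
  have hpm : ∀ x : ℝ, V ⟨x, 0⟩ = 1 ∨ V ⟨x, 0⟩ = -1 := fun x => sq_eq_one_iff.1 (hsq x)
  refine hV.eq_const (fun x => ?_) hz
  by_contra hne
  obtain ⟨x₁, hx₁⟩ := (htop.eventually (Metric.ball_mem_nhds e one_pos)).exists
  rw [Real.dist_eq, abs_lt] at hx₁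
  -- Passing from one of the values `±1` to the other would cross `0`, where the square is not `1`.
  have hzero : ∃ x, V ⟨x, 0⟩ = 0 := by
    rcases he with rfl | rfl
    · refine mem_range_of_exists_le_of_exists_ge hc ⟨x₁, by linarith⟩ ⟨x, ?_⟩
      rcases hpm x with h | h
      · rw [h]; norm_num
      · exact absurd h hne
    · refine mem_range_of_exists_le_of_exists_ge hc ⟨x, ?_⟩ ⟨x₁, by linarith⟩
      rcases hpm x with h | h
      · exact absurd h hne
      · rw [h]; norm_num
  obtain ⟨x₂, hx₂⟩ := hzero
  have := hsq x₂
  rw [hx₂] at this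
  norm_num at this

end IsDoubleWell

/-! ### Signed limits at infinity and the final case distinction -/

/-- Once `|v| > 0` on a half-line, the intermediate value theorem fixes the sign of `v` there. -/
lemma tendsto_one_or_neg_one {v : ℝ → ℝ} (hv : Continuous v)
    (h : Tendsto (fun x => |v x|) atTop (𝓝 1)) :
    Tendsto v atTop (𝓝 1) ∨ Tendsto v atTop (𝓝 (-1)) := by
  obtain ⟨X, hX⟩ := eventually_atTop.1 (h.eventually (eventually_gt_nhds zero_lt_one))
  have hne : ∀ x ≥ X, v x ≠ 0 := fun x hx => abs_pos.1 (hX x hx)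
  rcases (hne X le_rfl).lt_or_gt with h0 | h0
  · right
    have hneg : ∀ x ≥ X, v x < 0 := fun x hx => by
      by_contra! hle
      obtain ⟨c, hc, hc'⟩ := intermediate_value_Icc hx hv.continuousOn ⟨h0.le, hle⟩
      exact hne c hc.1 hc'
    refine h.neg.congr' ?_
    filter_upwards [eventually_ge_atTop X] with x hx
    rw [abs_of_neg (hneg x hx), neg_neg]
  · left
    have hpos : ∀ x ≥ X, 0 < v x := fun x hx => by
      by_contra! hle
      obtain ⟨c, hc, hc'⟩ := intermediate_value_Icc' hx hv.continuousOn ⟨hle, h0.le⟩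
      exact hne c hc.1 hc'
    refine h.congr' ?_
    filter_upwards [eventually_ge_atTop X] with x hx
    rw [abs_of_pos (hpos x hx)]

lemma tendsto_one_or_neg_one_atBot {v : ℝ → ℝ} (hv : Continuous v)
    (h : Tendsto (fun x => |v x|) atBot (𝓝 1)) :
    Tendsto v atBot (𝓝 1) ∨ Tendsto v atBot (𝓝 (-1)) := by
  have := tendsto_one_or_neg_one (v := fun x => v (-x)) (hv.comp continuous_neg)
    (h.comp tendsto_neg_atTop_atBot)
  refine this.imp (fun h => ?_) fun h => ?_ <;>
  · have := h.comp tendsto_neg_atBot_atTop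
    simpa [Function.comp_def] using this

lemma IsLayer.isConnection {f : ℝ → ℝ} {U : ℂ → ℝ} (hU : IsLayer f U) : IsConnection f U :=
  ⟨hU.isSolution, hU.tendsto_atBot, hU.tendsto_atTop⟩

end HalfPlane

open HalfPlane

theorem theorem2p5 (G : ℝ → ℝ) (hG : HalfPlane.IsDoubleWell G) :
    (∀ V : ℂ → ℝ, HalfPlane.IsSolution (HalfPlane.reaction G) V →
      Tendsto (fun x : ℝ => V ⟨x, 0⟩) atBot (𝓝 (-1)) →
      Tendsto (fun x : ℝ => V ⟨x, 0⟩) atTop (𝓝 (-1)) →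
      ∀ z : ℂ, 0 ≤ z.im → V z = -1) ∧
    (∀ V : ℂ → ℝ, HalfPlane.IsSolution (HalfPlane.reaction G) V →
      Tendsto (fun x : ℝ => |V ⟨x, 0⟩|) atBot (𝓝 1) →
      Tendsto (fun x : ℝ => |V ⟨x, 0⟩|) atTop (𝓝 1) →
      (∀ z : ℂ, 0 ≤ z.im → V z = 1) ∨
      (∀ z : ℂ, 0 ≤ z.im → V z = -1) ∨
      -- `V` or its reflection `(x, y) ↦ V (-x, y)` is a layer solution, and `V` is a translate of
      -- any given layer solution `U`, or of its reflection
      ((HalfPlane.IsLayer (HalfPlane.reaction G) V ∨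
          HalfPlane.IsLayer (HalfPlane.reaction G) (fun z : ℂ => V ⟨-z.re, z.im⟩)) ∧
        ∀ U : ℂ → ℝ, HalfPlane.IsLayer (HalfPlane.reaction G) U →
          ∃ b : ℝ, (∀ x y : ℝ, 0 ≤ y → V ⟨x, y⟩ = U ⟨x - b, y⟩) ∨
            (∀ x y : ℝ, 0 ≤ y → V ⟨x, y⟩ = U ⟨-(x - b), y⟩))) := by
  refine ⟨fun V hV hbot htop z hz => hG.eq_const_of_homoclinic hV (Or.inl rfl) hbot htop hz,
    fun V hV hbot htop => ?_⟩
  obtain ⟨r, hr, hleft, hright⟩ := hG.exists_strictAntiOn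
  rcases tendsto_one_or_neg_one_atBot hV.continuous_boundary hbot with hb | hb <;>
    rcases tendsto_one_or_neg_one hV.continuous_boundary htop with ht | ht
  · exact Or.inl fun z hz => hG.eq_const_of_homoclinic hV (Or.inr rfl) hb ht hz
  · have hc : IsConnection (reaction G) fun z : ℂ => V ⟨-z.re, z.im⟩ :=
      ⟨hV.reflect, ht.comp tendsto_neg_atBot_atTop, hb.comp tendsto_neg_atTop_atBot⟩
    refine Or.inr (Or.inr ⟨Or.inr (hc.isLayer hr hleft hright hG.differentiableOn_reaction),
      fun U hU => ?_⟩)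
    obtain ⟨b, hb, -⟩ := hc.exists_translate hU.isConnection hr hleft hright
    -- Evaluating the translation identity for the reflection at `-x` gives `V(x, y) = U(-x + b,
    -- y)`.
    refine ⟨b, Or.inr fun x y hy => ?_⟩
    have := hb ⟨-x, y⟩ hy
    rw [add_ofReal_mk] at this
    simpa only [neg_neg, neg_sub, neg_add_eq_sub] using this
  · have hc : IsConnection (reaction G) V := ⟨hV, hb, ht⟩
    refine Or.inr (Or.inr ⟨Or.inl (hc.isLayer hr hleft hright hG.differentiableOn_reaction),
      fun U hU => ?_⟩)
    obtain ⟨b, hb, -⟩ := hc.exists_translate hU.isConnection hr hleft hright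
    refine ⟨-b, Or.inl fun x y hy => ?_⟩
    have := hb ⟨x, y⟩ hy
    rwa [add_ofReal_mk, ← sub_neg_eq_add] at this
  · exact Or.inr (Or.inl fun z hz => hG.eq_const_of_homoclinic hV (Or.inl rfl) hb ht hz)
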